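/- **Setting.** In the client-server 2-spanner problem the input is a connected undirected simple graph $G=(V,E)$ on $n$ vertices with two sets of edges, the clients $C$ and the servers $S$, with $C\cup S=E$ (an edge may be both). A solution is a set $H\subseteq S$ such that for every client edge $\{u,v\}\in C$ there is a path of length at most $2$ between $u$ and $v$ in $H$; the goal is to minimize $|H|$. Let $V(C)$ be the set of vertices touched by client edges and $\Delta_S$ the maximum degree of $(V,S)$. In the LOCAL model the vertices have distinct identifiers and communicate over $G$ in synchronous rounds, with messages of unbounded size and unbounded local computation; each vertex has private randomness. Initially a vertex knows its identifier, the identifiers of its neighbours, which of its edges are clients and which are servers, and a number $N$ with $n\le N\le n^{a}$ for some constant $a$ (a polynomial upper bound on $n$). Each vertex irrevocably outputs a subset of its edges, and $H$ is the union of the outputs. The number of rounds of an execution is the number of rounds after which all vertices have produced their output. **Theorem.** There are a randomized algorithm in the LOCAL model and a constant $\alpha$ such that, on every instance that has a solution, the following hold. 1. (Guaranteed approximation.) In every execution in which all vertices have produced their output, whatever the random choices, the output $H$ is a solution, and for every solution $H'$ $$|H|\le \alpha\cdot\max\Bigl\{1,\ \min\Bigl\{\log\frac{|C|}{|V(C)|},\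 \log\Delta_S\Bigr\}\Bigr\}\cdot|H'| .$$ (If $C=\emptyset$, this says that $H=\emptyset$.) 2. (Rounds.) For all constants $a,c\in\mathbb{N}$ there is a constant $K$, depending only on $a$ and $c$, such that if $n\le N\le n^{a}$, then for every integer $t\ge K\cdot\max\{1,\ \log n\cdot\log\Delta_S\}$ all vertices have produced their output after $t$ rounds with probability at least $1-n^{-c}$. The algorithm and $\alpha$ do not depend on $a$ and $c$. Here $\log$ is the natural logarithm, and $\log 0$ (which occurs only for $n=1$) is read as $0$. -/

import Mathlib

/-! ### Spanners -/

/-- The pair `{u, v}` is covered by `H` within `k` hops: `H` contains a path of length at most `k`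
between `u` and `v`. -/
def Covers {V : Type} (k : ℕ) (H : SimpleGraph V) (u v : V) : Prop :=
  ∃ p : H.Walk u v, p.IsPath ∧ p.length ≤ k

/-- `H` is a feasible solution of the client-server `k`-spanner problem with client edges `C` and
server edges `S`: it uses only server edges, and it covers all client edges. -/
def IsClientServerSpanner {V : Type} (k : ℕ) (C S H : SimpleGraph V) : Prop :=
  H ≤ S ∧ ∀ u v, C.Adj u v → Covers k H u v

/-- The number of edges of a graph. -/
noncomputable def edgeCount {V : Type} (H : SimpleGraph V) : ℕ := H.edgeSet.ncard

/-- The number of vertices that touch an edge of the graph. -/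
noncomputable def touchedCount {V : Type} (H : SimpleGraph V) : ℕ := H.support.ncard

/-- The maximum degree of a graph on a finite vertex set. -/
noncomputable def maxDeg {V : Type} [Fintype V] (H : SimpleGraph V) : ℕ :=
  Finset.univ.sup fun v => (H.neighborSet v).ncard

/-! ### Randomized algorithms in the LOCAL model -/

/-- A randomized synchronous message-passing algorithm, with messages of unbounded size and
unbounded local computation; all vertices run the same program. A vertex starts in a state that is
computed from an upper bound `N` on the number of vertices and from its own local input. In each
round it sends to each neighbour a message that is computed from its state and the identifier of
that neighbour, receives the messages of its neighbours (each paired with the identifier of its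
sender), draws a private uniform number from `{0, …, range N}`, and computes its new state.
A vertex may announce its output at any time; an announced output is final. -/
structure LocalAlgorithm (Input Output : Type) where
  State : Type
  Msg : Type
  range : ℕ → ℕ
  start : ℕ → Input → State
  send : State → ℕ → Msg
  step : State → Set (ℕ × Msg) → ℕ → State
  output : State → Option Output
  output_final : ∀ s inbox r o, output s = some o → output (step s inbox r) = some o

namespace LocalAlgorithm

variable {Input Output V : Type}

/-- The messages that `v` receives in one round on the network `G`, when the vertices are in the
states `σ`. -/
def inbox (A : LocalAlgorithm Input Output) (G : SimpleGraph V) (ident : V → ℕ)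
    (σ : V → A.State) (v : V) : Set (ℕ × A.Msg) :=
  {m | ∃ w, G.Adj v w ∧ m = (ident w, A.send (σ w) (ident v))}

/-- One synchronous round, in which the vertices draw the random numbers `r`. -/
def round (A : LocalAlgorithm Input Output) (G : SimpleGraph V) (ident : V → ℕ)
    (σ : V → A.State) (r : V → ℕ) : V → A.State :=
  fun v => A.step (σ v) (A.inbox G ident σ v) (r v)

/-- The distribution of the global state after `t` rounds. In each round the vertices draw fresh
independent uniform numbers, that is, a uniform element of the product over the vertices. -/
noncomputable def law (A : LocalAlgorithm Input Output) [Fintype V] (G : SimpleGraph V)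
    (ident : V → ℕ) (N : ℕ) (input : V → Input) : ℕ → PMF (V → A.State)
  | 0 => PMF.pure fun v => A.start N (input v)
  | t + 1 => (A.law G ident N input t).bind fun σ =>
      letI : DecidableEq V := Classical.decEq V
      (PMF.uniformOfFintype (V → Fin (A.range N + 1))).map fun r =>
        A.round G ident σ fun v => (r v : ℕ)

/-- All vertices have announced their outputs. -/
def Done (A : LocalAlgorithm Input Output) (σ : V → A.State) : Prop :=
  ∀ v, ∃ o, A.output (σ v) = some o

end LocalAlgorithm

/-! ### The client-server problem as a distributed problem -/

/-- What a vertex knows initially: its own identifier, and the identifiers of the neighbours to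
which it is joined by a client edge and by a server edge. -/
structure ClientServerInput where
  self : ℕ
  clients : Set ℕ
  servers : Set ℕ

/-- The local input of each vertex. -/
def clientServerInput {V : Type} (C S : SimpleGraph V) (ident : V → ℕ) (v : V) :
    ClientServerInput where
  self := ident v
  clients := ident '' C.neighborSet v
  servers := ident '' S.neighborSet v

/-- A vertex outputs a set of edges at itself, each named by the identifier of its other endpoint.
These are the edges in the union of the outputs `o`. -/
def outputGraph {V : Type} (ident : V → ℕ) (o : V → Set ℕ) : SimpleGraph V :=
  SimpleGraph.fromRel fun u v => ident v ∈ o u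

/-- The outputs name only edges of the network `G`. -/
def OutputsLegal {V : Type} (G : SimpleGraph V) (ident : V → ℕ) (o : V → Set ℕ) : Prop :=
  ∀ v, o v ⊆ ident '' G.neighborSet v

/-!
The algorithm is a parallel version of the greedy algorithm for set cover. The elements are the
ordered client pairs `(a, b)`, the sets are the stars `(v, T)` with a leaf set `T` of server
neighbours of `v`, and the cost of a star is `|T|`. A graph covers a client edge within two hops iff
some star of it contains both ends (`covers_two_iff`), so a solution `H'` is a family of stars of
total cost `2 |H'|`.

*Selection rule.* For a set of uncovered pairs, the core of `v` at level `i` is the largest leaf set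
in which every leaf has at least `2 ^ i` uncovered client edges inside the star. Cores have density
at least `2 ^ i` (`two_pow_mul_ncard_core_le`); if `v` has no core at level `i`, then all its stars
have density at most `2 ^ (i + 1)` (`ncard_uncovered_le_of_core_empty`); and cores shrink when
more pairs get covered (`core_mono`). In one iteration, a vertex with a core is a candidate for its
highest level if no vertex within distance two has a higher one. Candidates draw random numbers,
each uncovered pair votes for the candidate with the strictly smallest number among those whose core
contains it, and a candidate buys its core if it gets the votes of an eighth of its pairs. The rule
depends on the network within distance six only (`Agree.nextBought_eq`), hence can be executed in
seven rounds (`law_eq_map_configLaw`). A vertex stops when its neighbourhood contains no uncovered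
pair.

*Approximation.* The cost of a bought star of level `i` is charged to its voters, `8 / 2 ^ i` each.
Any competing star that contains such a voter has its centre within distance two of the bought star,
so its density is `O(2 ^ i)` at that moment. Hence, as for sequential greedy, the `l` pairs that a
star of cost `k` of `H'` is responsible for pay `O(k + k * log (l / k))` in total
(`Priced.next`, `sum_starPrice_le`). This holds for all random choices. Since
`k * log (l / k) ≤ l / q + k * log q` for every `q ≥ 1`, summing over the stars of `H'` with
`q = |C| / |V(C)|` and with `q = Δ_S` gives both bounds (`Priced.sum_ncard_le`): the
number of client edges is at most `q * |V(C)| ≤ 2 * q * |H'|` in the first case, and `l = O(k * q)`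
in the second.

*Rounds.* Let `Φ i` be the number of pairs of a vertex `v` and an element of the core star of `v` at
level `i`. At the highest level `m` that occurs, all vertices with a core are candidates. An element
`e` claimed by `d` of them votes for a given one with probability about `1 / d`; given this vote,
every element with at most `d` claimants votes for the same vertex with probability almost `1 / 2`.
If at least half of the elements of the star are of this kind, the star is bought with constant
probability (`le_card_vote_and_success`); then all `d` claims on `e` disappear. So `Φ m` drops by a
constant factor in expectation (`le_sum_card_claims_inter_winners`). With a base `B` larger than all
`Φ i`, the potential `∑ i, B ^ i * Φ i` is dominated by level `m`, never increases, and drops by a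
constant factor in expectation (`sum_potential_next_le`). It starts below `B ^ (log₂ Δ_S + 1)`,
where `B = n ^ 3 + 1`, and it is at least one as long as some pair is uncovered, so
`O(log n * log Δ_S)` iterations suffice with high probability by Markov's inequality.
-/

namespace StarGreedy

/-! ### Local views and the star-selection rule -/

/-- What is known about one vertex: the other ends of its client and server edges, the leaves of the
stars it has bought so far, and its current random number. -/
structure VertexRecord (X : Type) where
  clients : Set X
  servers : Set X
  bought : Set X
  draw : ℕ

/-- Rename the vertices in a record. -/
def VertexRecord.map {X Y : Type} (f : X → Y) (r : VertexRecord X) : VertexRecord Y :=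
  ⟨f '' r.clients, f '' r.servers, f '' r.bought, r.draw⟩

/-- A record for every vertex. The selection rule below is stated for an arbitrary vertex type, so
that the same definitions describe the global process (vertices in `V`) and what a vertex computes
from the part of the network it has seen (vertices named by identifiers). -/
abbrev World (X : Type) := X → VertexRecord X

section Rule

variable {X : Type} (W : World X)

/-- The closed server neighbourhood of a vertex. -/
def hub (v : X) : Set X := insert v (W v).servers

/-- The vertices of the star that `v` has bought, with its centre. -/
def boughtStar (v : X) : Set X := insert v (W v).bought

/-- The ordered pair `(a, b)` is a client edge that lies in no bought star. Only centres in the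
server neighbourhood of `a` are inspected, which makes this a local condition. -/
def Uncovered (a b : X) : Prop :=
  b ∈ (W a).clients ∧ ∀ w ∈ hub W a, ¬ (a ∈ boughtStar W w ∧ b ∈ boughtStar W w)

/-- `T` is a set of leaves for a star at `v` such that every leaf has at least `2 ^ i` uncovered
client edges inside the star. -/
def IsCore (v : X) (i : ℕ) (T : Set X) : Prop :=
  T ⊆ (W v).servers ∧ ∀ u ∈ T, 2 ^ i ≤ {b | b ∈ insert v T ∧ Uncovered W u b}.ncard

/-- The largest leaf set of minimum uncovered degree `2 ^ i` for a star at `v`. -/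
def core (v : X) (i : ℕ) : Set X := {u | ∃ T, IsCore W v i T ∧ u ∈ T}

/-- The vertices within server distance two. -/
def nearby (v : X) : Set X := {w | ∃ x ∈ hub W v, w ∈ hub W x}

/-- `v` is a candidate at level `i`: it has a nonempty core at this level, and no vertex within
server distance two has one at a higher level. -/
def IsCandidate (v : X) (i : ℕ) : Prop :=
  (core W v i).Nonempty ∧ ∀ w ∈ nearby W v, ∀ j, i < j → ¬ (core W w j).Nonempty

/-- The uncovered ordered client pairs inside the star of `v` at level `i`. -/
def claims (v : X) (i : ℕ) : Set (X × X) :=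
  {p | p.1 ∈ insert v (core W v i) ∧ p.2 ∈ insert v (core W v i) ∧ Uncovered W p.1 p.2}

/-- The pairs that vote for `v` at level `i`: the candidate `v` claims them, and it has a strictly
smaller random number than all other candidates that claim them. -/
def votes (v : X) (i : ℕ) : Set (X × X) :=
  {p | p ∈ claims W v i ∧ ∀ w ∈ hub W p.1, w ≠ v → ∀ j, IsCandidate W w j → p ∈ claims W w j →
    (W v).draw < (W w).draw}

/-- The candidate `v` buys its star at level `i` if an eighth of its claims vote for it. -/
def IsChosen (v : X) (i : ℕ) : Prop :=
  IsCandidate W v i ∧ (claims W v i).ncard ≤ 8 * (votes W v i).ncard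

/-- The leaves that `v` has bought after one iteration. -/
def nextBought (v : X) : Set X := (W v).bought ∪ {u | ∃ i, IsChosen W v i ∧ u ∈ core W v i}

/-- No uncovered client edge lies in the server neighbourhood of `v`; such a vertex never buys
again. -/
def IsQuiet (v : X) : Prop := ∀ a ∈ hub W v, ∀ b ∈ hub W v, ¬ Uncovered W a b

end Rule

/-! ### Locality of the selection rule -/

section Transfer

variable {X Y : Type} {f : X → Y} {W : World X} {W' : World Y}

/-- The worlds `W` and `W'` look the same, up to the renaming `f`, within server distance `k` of
`x`. -/
def Agree (f : X → Y) (W : World X) (W' : World Y) : ℕ → X → Prop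
  | 0, x => W' (f x) = (W x).map f
  | k + 1, x => W' (f x) = (W x).map f ∧ ∀ y ∈ (W x).servers, Agree f W W' k y

theorem Agree.map_eq {k : ℕ} {x : X} (h : Agree f W W' k x) : W' (f x) = (W x).map f := by
  cases k with
  | zero => exact h
  | succ k => exact h.1

theorem Agree.pred {k : ℕ} : ∀ {x : X}, Agree f W W' (k + 1) x → Agree f W W' k x := by
  induction k with
  | zero => exact fun h => h.1
  | succ k ih => exact fun h => ⟨h.1, fun y hy => ih (h.2 y hy)⟩

theorem Agree.mono {k l : ℕ} (hkl : k ≤ l) {x : X} (h : Agree f W W' l x) : Agree f W W' k x := by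
  induction hkl with
  | refl => exact h
  | step _ ih => exact ih h.pred

theorem Agree.hub {k : ℕ} {x y : X} (h : Agree f W W' (k + 1) x) (hy : y ∈ hub W x) :
    Agree f W W' k y := by
  rcases hy with rfl | hy
  · exact h.pred
  · exact h.2 y hy

theorem Agree.hub_eq {k : ℕ} {x : X} (h : Agree f W W' k x) :
    StarGreedy.hub W' (f x) = f '' StarGreedy.hub W x := by
  simp only [StarGreedy.hub, h.map_eq, VertexRecord.map, Set.image_insert_eq]

theorem Agree.boughtStar_eq {k : ℕ} {x : X} (h : Agree f W W' k x) :
    boughtStar W' (f x) = f '' boughtStar W x := by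
  simp only [boughtStar, h.map_eq, VertexRecord.map, Set.image_insert_eq]

theorem Agree.uncovered_iff (hf : Function.Injective f) {a b : X} (h : Agree f W W' 1 a) :
    Uncovered W' (f a) (f b) ↔ Uncovered W a b := by
  unfold Uncovered
  rw [h.hub_eq, Set.forall_mem_image]
  refine and_congr ?_ (forall₂_congr fun w hw => ?_)
  · rw [h.map_eq]; exact hf.mem_set_image
  · rw [(h.hub hw).boughtStar_eq, hf.mem_set_image, hf.mem_set_image]

theorem Agree.isCore_image_iff (hf : Function.Injective f) {v : X} (h : Agree f W W' 2 v) (i : ℕ)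
    (T : Set X) : IsCore W' (f v) i (f '' T) ↔ IsCore W v i T := by
  unfold IsCore
  rw [h.map_eq]
  change f '' T ⊆ f '' _ ∧ _ ↔ _
  rw [Set.image_subset_image_iff hf, Set.forall_mem_image]
  refine and_congr_right fun hT => forall₂_congr fun u hu => ?_
  have : {b | b ∈ insert (f v) (f '' T) ∧ Uncovered W' (f u) b}
      = f '' {b | b ∈ insert v T ∧ Uncovered W u b} := by
    rw [← Set.image_insert_eq]
    ext y
    constructor
    · rintro ⟨⟨b, hb, rfl⟩, hy⟩
      exact ⟨b, ⟨hb, ((h.2 u (hT hu)).uncovered_iff hf).1 hy⟩, rfl⟩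
    · rintro ⟨b, ⟨hb, hy⟩, rfl⟩
      exact ⟨⟨b, hb, rfl⟩, ((h.2 u (hT hu)).uncovered_iff hf).2 hy⟩
  rw [this, Set.ncard_image_of_injective _ hf]

theorem Agree.core_eq (hf : Function.Injective f) {v : X} (h : Agree f W W' 2 v) (i : ℕ) :
    core W' (f v) i = f '' core W v i := by
  ext y
  constructor
  · rintro ⟨T', hT', hy⟩
    have hsub : T' ⊆ f '' (W v).servers := by
      have := hT'.1
      rwa [h.map_eq] at this
    obtain ⟨T, -, rfl⟩ := Set.subset_image_iff.1 hsub
    obtain ⟨u, hu, rfl⟩ := hy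
    exact ⟨u, ⟨T, (h.isCore_image_iff hf i T).1 hT', hu⟩, rfl⟩
  · rintro ⟨u, ⟨T, hT, hu⟩, rfl⟩
    exact ⟨f '' T, (h.isCore_image_iff hf i T).2 hT, Set.mem_image_of_mem f hu⟩

theorem Agree.nearby_eq {v : X} (h : Agree f W W' 1 v) :
    nearby W' (f v) = f '' nearby W v := by
  ext y
  simp only [nearby, h.hub_eq, Set.mem_ofPred_eq, Set.exists_mem_image]
  constructor
  · rintro ⟨x, hx, hy⟩
    rw [(h.hub hx).hub_eq] at hy
    obtain ⟨w, hw, rfl⟩ := hy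
    exact ⟨w, ⟨x, hx, hw⟩, rfl⟩
  · rintro ⟨w, ⟨x, hx, hw⟩, rfl⟩
    refine ⟨x, hx, ?_⟩
    rw [(h.hub hx).hub_eq]
    exact ⟨w, hw, rfl⟩

theorem Agree.isCandidate_iff (hf : Function.Injective f) {v : X} (h : Agree f W W' 4 v) (i : ℕ) :
    IsCandidate W' (f v) i ↔ IsCandidate W v i := by
  unfold IsCandidate
  rw [(h.mono (by norm_num)).core_eq hf, (h.mono (k := 1) (by norm_num)).nearby_eq,
    Set.forall_mem_image, Set.image_nonempty]
  refine and_congr_right fun _ => forall₂_congr fun w hw => ?_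
  obtain ⟨x, hx, hw⟩ := hw
  simp only [((h.hub hx).hub hw).core_eq hf, Set.image_nonempty]

theorem subset_servers_of_core (v : X) (i : ℕ) : core W v i ⊆ (W v).servers := by
  rintro u ⟨T, hT, hu⟩
  exact hT.1 hu

theorem insert_core_subset_hub (v : X) (i : ℕ) : insert v (core W v i) ⊆ hub W v :=
  Set.insert_subset_insert (subset_servers_of_core v i)

theorem Agree.mem_claims_iff (hf : Function.Injective f) {v : X} (h : Agree f W W' 2 v) (i : ℕ)
    (p : X × X) : Prod.map f f p ∈ claims W' (f v) i ↔ p ∈ claims W v i := by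
  simp only [claims, h.core_eq hf, ← Set.image_insert_eq, Set.mem_ofPred_eq, Prod.map_fst,
    Prod.map_snd, hf.mem_set_image]
  refine and_congr_right fun h1 => and_congr_right fun _ => ?_
  exact (h.hub (insert_core_subset_hub v i h1)).uncovered_iff hf

theorem Agree.claims_eq (hf : Function.Injective f) {v : X} (h : Agree f W W' 2 v) (i : ℕ) :
    claims W' (f v) i = Prod.map f f '' claims W v i := by
  ext q
  constructor
  · intro hq
    have h1 := hq.1
    have h2 := hq.2.1
    rw [h.core_eq hf, ← Set.image_insert_eq] at h1 h2
    obtain ⟨a, -, ha⟩ := h1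
    obtain ⟨b, -, hb⟩ := h2
    obtain rfl : Prod.map f f (a, b) = q := Prod.ext ha hb
    exact ⟨(a, b), (h.mem_claims_iff hf i _).1 hq, rfl⟩
  · rintro ⟨p, hp, rfl⟩
    exact (h.mem_claims_iff hf i p).2 hp

theorem Agree.votes_eq (hf : Function.Injective f) {v : X} (h : Agree f W W' 6 v) (i : ℕ) :
    votes W' (f v) i = Prod.map f f '' votes W v i := by
  have key : ∀ p ∈ claims W v i, (Prod.map f f p ∈ votes W' (f v) i ↔ p ∈ votes W v i) := by
    intro p hp
    have hp1 := h.hub (insert_core_subset_hub v i hp.1)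
    simp only [votes, Set.mem_ofPred_eq, (h.mono (k := 2) (by norm_num)).mem_claims_iff hf,
      Prod.map_fst, hp1.hub_eq, Set.forall_mem_image, hf.ne_iff]
    refine and_congr_right fun _ => forall₂_congr fun w hw => forall_congr' fun _ =>
      forall_congr' fun j => ?_
    have hw' := hp1.hub hw
    rw [hw'.isCandidate_iff hf, (hw'.mono (k := 2) (by norm_num)).mem_claims_iff hf, h.map_eq,
      hw'.map_eq]
    rfl
  ext q
  constructor
  · intro hq
    have hq' := hq.1
    rw [(h.mono (k := 2) (by norm_num)).claims_eq hf] at hq'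
    obtain ⟨p, hp, rfl⟩ := hq'
    exact ⟨p, (key p hp).1 hq, rfl⟩
  · rintro ⟨p, hp, rfl⟩
    exact (key p hp.1).2 hp

/-- The leaves bought by `v` in one iteration depend only on the network within server distance six:
one step to a leaf of the star of `v`, one to a rival centre of a claimed pair, two to a vertex that
may prevent this rival from being a candidate, and two to evaluate the core there. -/
theorem Agree.nextBought_eq (hf : Function.Injective f) {v : X} (h : Agree f W W' 6 v) :
    nextBought W' (f v) = f '' nextBought W v := by
  have h2 := h.mono (k := 2) (by norm_num)
  have hch : ∀ i, IsChosen W' (f v) i ↔ IsChosen W v i := fun i => by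
    unfold IsChosen
    rw [(h.mono (k := 4) (by norm_num)).isCandidate_iff hf, h2.claims_eq hf, h.votes_eq hf,
      Set.ncard_image_of_injective _ (hf.prodMap hf),
      Set.ncard_image_of_injective _ (hf.prodMap hf)]
  unfold nextBought
  rw [Set.image_union, h.map_eq]
  refine congrArg₂ _ rfl ?_
  ext y
  simp only [hch, h2.core_eq hf, Set.mem_ofPred_eq, Set.mem_image]
  aesop

theorem Agree.isQuiet_iff (hf : Function.Injective f) {v : X} (h : Agree f W W' 2 v) :
    IsQuiet W' (f v) ↔ IsQuiet W v := by
  unfold IsQuiet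
  simp only [h.hub_eq, Set.forall_mem_image]
  exact forall₂_congr fun a ha => forall₂_congr fun b _ => not_congr ((h.hub ha).uncovered_iff hf)

end Transfer

/-! ### Stars and cores on a finite graph -/

section Graph

variable {V : Type} (C S : SimpleGraph V)

/-- The global configuration: clients `C`, servers `S`, bought leaves `out`, random numbers `r`. -/
def world (out : V → Set V) (r : V → ℕ) : World V := fun v =>
  ⟨C.neighborSet v, S.neighborSet v, out v, r v⟩

variable {C S} {out out' : V → Set V} {r r' : V → ℕ}

theorem hub_symm {v w : V} (h : w ∈ hub (world C S out r) v) : v ∈ hub (world C S out r) w := by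
  rcases h with rfl | h
  · exact Or.inl rfl
  · exact Or.inr (SimpleGraph.Adj.symm h)

theorem Uncovered.mono (h : ∀ v, out v ⊆ out' v) {a b : V}
    (hu : Uncovered (world C S out' r') a b) : Uncovered (world C S out r) a b :=
  ⟨hu.1, fun w hw hab => hu.2 w hw ⟨Set.insert_subset_insert (h w) hab.1,
    Set.insert_subset_insert (h w) hab.2⟩⟩

theorem Uncovered.symm (hout : ∀ v, out v ⊆ S.neighborSet v) {a b : V}
    (hu : Uncovered (world C S out r) a b) : Uncovered (world C S out r) b a := by
  refine ⟨SimpleGraph.Adj.symm hu.1, fun w _ hab => hu.2 w ?_ hab.symm⟩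
  exact hub_symm (Set.insert_subset_insert (hout w) hab.2)

theorem Uncovered.ne {a b : V} (hu : Uncovered (world C S out r) a b) : a ≠ b :=
  C.ne_of_adj hu.1

theorem IsCore.mono [Finite V] {v : V} {i : ℕ} {T : Set V} (h : ∀ v, out v ⊆ out' v)
    (hT : IsCore (world C S out' r') v i T) : IsCore (world C S out r) v i T :=
  ⟨hT.1, fun u hu => (hT.2 u hu).trans <|
    Set.ncard_le_ncard (fun _ hb => ⟨hb.1, hb.2.mono h⟩) (Set.toFinite _)⟩

theorem core_mono [Finite V] (h : ∀ v, out v ⊆ out' v) (v : V) (i : ℕ) :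
    core (world C S out' r') v i ⊆ core (world C S out r) v i := by
  rintro u ⟨T, hT, hu⟩
  exact ⟨T, hT.mono h, hu⟩

theorem claims_mono [Finite V] (h : ∀ v, out v ⊆ out' v) (v : V) (i : ℕ) :
    claims (world C S out' r') v i ⊆ claims (world C S out r) v i := fun _ hp =>
  ⟨Set.insert_subset_insert (core_mono h v i) hp.1,
    Set.insert_subset_insert (core_mono h v i) hp.2.1, hp.2.2.mono h⟩

theorem isCore_core [Finite V] (W : World V) (v : V) (i : ℕ) : IsCore W v i (core W v i) := by
  refine ⟨subset_servers_of_core v i, ?_⟩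
  rintro u ⟨T, hT, hu⟩
  refine (hT.2 u hu).trans (Set.ncard_le_ncard (fun b hb => ⟨?_, hb.2⟩) (Set.toFinite _))
  exact Set.insert_subset_insert (fun x hx => (⟨T, hT, hx⟩ : x ∈ core W v i)) hb.1

theorem two_pow_mul_ncard_core_le [Finite V] (W : World V) (v : V) (i : ℕ) :
    2 ^ i * (core W v i).ncard ≤ (claims W v i).ncard := by
  classical
  have := Fintype.ofFinite V
  have h1 := isCore_core W v i
  rw [Set.ncard_eq_toFinset_card' (core W v i), Set.ncard_eq_toFinset_card' (claims W v i),
    mul_comm]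
  calc (core W v i).toFinset.card * 2 ^ i
      ≤ ∑ u ∈ (core W v i).toFinset,
          ((claims W v i).toFinset.filter fun p => p.1 = u).card := by
        rw [← smul_eq_mul]
        refine Finset.card_nsmul_le_sum _ _ _ fun u hu => ?_
        rw [Set.mem_toFinset] at hu
        refine (h1.2 u hu).trans ?_
        rw [← Set.ncard_image_of_injective _ (Prod.mk_right_injective u),
          ← Set.ncard_coe_finset]
        refine Set.ncard_le_ncard ?_ (Set.toFinite _)
        rintro _ ⟨b, hb, rfl⟩
        simp only [Finset.coe_filter, Set.mem_toFinset, Set.mem_ofPred_eq, and_true]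
        exact ⟨Or.inr hu, hb.1, hb.2⟩
    _ = ((claims W v i).toFinset.filter fun p => p.1 ∈ (core W v i).toFinset).card := by
        rw [Finset.card_eq_sum_card_fiberwise (f := Prod.fst) (t := (core W v i).toFinset)
          (s := (claims W v i).toFinset.filter fun p => p.1 ∈ (core W v i).toFinset)
          (fun p hp => (Finset.mem_filter.1 hp).2)]
        refine Finset.sum_congr rfl fun u hu => ?_
        rw [Finset.filter_filter]
        congr 1
        ext p
        simp only [Finset.mem_filter]
        constructor
        · rintro ⟨h, rfl⟩; exact ⟨h, hu, rfl⟩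
        · rintro ⟨h, -, h'⟩; exact ⟨h, h'⟩
    _ ≤ _ := Finset.card_filter_le _ _

/-- If `v` has no core at level `i`, then its stars have few uncovered pairs: every star has a leaf
of small uncovered degree, and these leaves can be peeled off one by one. -/
theorem ncard_uncovered_le_of_core_empty [Finite V] (hout : ∀ v, out v ⊆ S.neighborSet v)
    {v : V} {i : ℕ} (hv : ¬ (core (world C S out r) v i).Nonempty) (T : Set V)
    (hT : T ⊆ S.neighborSet v) :
    {p : V × V | p.1 ∈ insert v T ∧ p.2 ∈ insert v T ∧
      Uncovered (world C S out r) p.1 p.2}.ncard ≤ 2 * 2 ^ i * T.ncard := by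
  induction hn : T.ncard generalizing T with
  | zero =>
    obtain rfl := (Set.ncard_eq_zero (Set.toFinite T)).1 hn
    rw [mul_zero, Nat.le_zero, Set.ncard_eq_zero (Set.toFinite _), Set.eq_empty_iff_forall_notMem]
    rintro ⟨a, b⟩ ⟨ha, hb, hab⟩
    simp only [insert_empty_eq, Set.mem_singleton_iff] at ha hb
    exact hab.ne (ha.trans hb.symm)
  | succ n ih =>
    have hne : T.Nonempty := Set.nonempty_of_ncard_ne_zero (by omega)
    have hnc : ¬ IsCore (world C S out r) v i T := fun h =>
      hv (hne.imp fun u hu => ⟨T, h, hu⟩)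
    have : ∃ u ∈ T, {b | b ∈ insert v T ∧ Uncovered (world C S out r) u b}.ncard < 2 ^ i := by
      by_contra! h
      exact hnc ⟨hT, h⟩
    obtain ⟨u, hu, hlt⟩ := this
    have hcard : (T \ {u}).ncard = n := by
      rw [Set.ncard_sdiff_singleton_of_mem hu, hn]; rfl
    have := ih (T \ {u}) (Set.sdiff_subset.trans hT) hcard
    set D := {b | b ∈ insert v T ∧ Uncovered (world C S out r) u b} with hD
    have hsub : {p : V × V | p.1 ∈ insert v T ∧ p.2 ∈ insert v T ∧
        Uncovered (world C S out r) p.1 p.2} ⊆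
        {p : V × V | p.1 ∈ insert v (T \ {u}) ∧ p.2 ∈ insert v (T \ {u}) ∧
        Uncovered (world C S out r) p.1 p.2} ∪
        ((fun b => (u, b)) '' D ∪ (fun b => (b, u)) '' D) := by
      rintro ⟨a, b⟩ ⟨ha, hb, hab⟩
      by_cases hau : a = u
      · subst hau
        exact Or.inr (Or.inl ⟨b, ⟨hb, hab⟩, rfl⟩)
      by_cases hbu : b = u
      · subst hbu
        exact Or.inr (Or.inr ⟨a, ⟨ha, hab.symm hout⟩, rfl⟩)
      refine Or.inl ⟨?_, ?_, hab⟩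
      · rcases ha with h | h
        · exact Or.inl h
        · exact Or.inr ⟨h, hau⟩
      · rcases hb with h | h
        · exact Or.inl h
        · exact Or.inr ⟨h, hbu⟩
    have h1 := Set.ncard_le_ncard hsub (Set.toFinite _)
    have h2 := h1.trans (Set.ncard_union_le _ _)
    have h3 := Set.ncard_union_le ((fun b => (u, b)) '' D) ((fun b => (b, u)) '' D)
    have h4 := Set.ncard_image_le (f := fun b => (u, b)) (Set.toFinite D)
    have h5 := Set.ncard_image_le (f := fun b => (b, u)) (Set.toFinite D)
    have h6 : 2 * 2 ^ i * (n + 1) = 2 * 2 ^ i * n + 2 * 2 ^ i := by ring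
    omega

/-- A bought star covers all pairs that it claims. -/
theorem not_uncovered_of_isChosen {v : V} {i : ℕ} (hv : IsChosen (world C S out r) v i) {p : V × V}
    (hp : p ∈ claims (world C S out r) v i) :
    ¬ Uncovered (world C S (nextBought (world C S out r)) r') p.1 p.2 := by
  intro hu
  have hsub : insert v (core (world C S out r) v i) ⊆
      boughtStar (world C S (nextBought (world C S out r)) r') v :=
    Set.insert_subset_insert fun u hu => Or.inr ⟨i, hv, hu⟩
  exact hu.2 v (hub_symm (r := r) (out := out) (insert_core_subset_hub v i hp.1))
    ⟨hsub hp.1, hsub hp.2.1⟩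

theorem subset_nextBought (v : V) : out v ⊆ nextBought (world C S out r) v := Set.subset_union_left

theorem nextBought_subset (hout : ∀ v, out v ⊆ S.neighborSet v) (v : V) :
    nextBought (world C S out r) v ⊆ S.neighborSet v := by
  rintro u (hu | ⟨i, -, hu⟩)
  · exact hout v hu
  · exact subset_servers_of_core (W := world C S out r) v i hu

theorem core_eq_empty_of_isQuiet {v : V} (hq : IsQuiet (world C S out r) v) (i : ℕ) :
    core (world C S out r) v i = ∅ := by
  rw [Set.eq_empty_iff_forall_notMem]
  rintro u ⟨T, hT, hu⟩
  have : 0 < {b | b ∈ insert v T ∧ Uncovered (world C S out r) u b}.ncard :=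
    (Nat.two_pow_pos i).trans_le (hT.2 u hu)
  obtain ⟨b, hb, hub⟩ := Set.nonempty_of_ncard_ne_zero this.ne'
  exact hq u (Or.inr (hT.1 hu)) b (Set.insert_subset_insert hT.1 hb) hub

theorem nextBought_eq_of_isQuiet {v : V} (hq : IsQuiet (world C S out r) v) :
    nextBought (world C S out r) v = out v := by
  simp only [nextBought, core_eq_empty_of_isQuiet hq]
  simp [world]

theorem exists_core_zero [Finite V] (hout : ∀ v, out v ⊆ S.neighborSet v) {a b v : V}
    (ha : a ∈ insert v (S.neighborSet v)) (hb : b ∈ insert v (S.neighborSet v))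
    (hu : Uncovered (world C S out r) a b) : (core (world C S out r) v 0).Nonempty := by
  have hIs : IsCore (world C S out r) v 0 ({a, b} \ {v}) := by
    refine ⟨?_, ?_⟩
    · rintro x ⟨rfl | rfl, hx⟩
      · exact ha.resolve_left hx
      · exact hb.resolve_left hx
    · rintro x ⟨rfl | rfl, hx⟩
      · refine (Set.ncard_pos (Set.toFinite _)).2 ⟨b, ?_, hu⟩
        by_cases h : b = v
        · exact Or.inl h
        · exact Or.inr ⟨Or.inr rfl, h⟩
      · refine (Set.ncard_pos (Set.toFinite _)).2 ⟨a, ?_, hu.symm hout⟩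
        by_cases h : a = v
        · exact Or.inl h
        · exact Or.inr ⟨Or.inl rfl, h⟩
  by_cases h : a = v
  · refine ⟨b, _, hIs, Or.inr rfl, fun hbv => hu.ne (h.trans hbv.symm)⟩
  · exact ⟨a, _, hIs, Or.inl rfl, h⟩

theorem IsCandidate.level_unique {W : World V} {v : V} {i j : ℕ} (hi : IsCandidate W v i)
    (hj : IsCandidate W v j) : i = j := by
  have hv : v ∈ nearby W v := ⟨v, Or.inl rfl, Or.inl rfl⟩
  rcases lt_trichotomy i j with h | h | h
  · exact absurd hj.1 (hi.2 v hv j h)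
  · exact h
  · exact absurd hi.1 (hj.2 v hv i h)

theorem centre_mem_hub_of_mem_claims {v : V} {i : ℕ} {p : V × V}
    (hp : p ∈ claims (world C S out r) v i) : v ∈ hub (world C S out r) p.1 :=
  hub_symm (insert_core_subset_hub v i hp.1)

/-- A pair votes for at most one candidate. -/
theorem votes_unique {x y : V × ℕ} {p : V × V}
    (hx : IsCandidate (world C S out r) x.1 x.2) (hy : IsCandidate (world C S out r) y.1 y.2)
    (hpx : p ∈ votes (world C S out r) x.1 x.2) (hpy : p ∈ votes (world C S out r) y.1 y.2) :
    x = y := by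
  have h1 : x.1 = y.1 := by
    by_contra h
    have h1 := hpx.2 y.1 (centre_mem_hub_of_mem_claims hpy.1) (Ne.symm h) y.2 hy hpy.1
    have h2 := hpy.2 x.1 (centre_mem_hub_of_mem_claims hpx.1) h x.2 hx hpx.1
    exact lt_asymm h1 h2
  rw [← h1] at hy
  exact Prod.ext h1 (hx.level_unique hy)

theorem core_nonempty_of_mem_claims {r : V → ℕ} {v : V} {i : ℕ} {p : V × V}
    (hp : p ∈ claims (world C S out r) v i) : (core (world C S out r) v i).Nonempty := by
  rcases hp.1 with h1 | h1
  · rcases hp.2.1 with h2 | h2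
    · exact absurd (h1.trans h2.symm) hp.2.2.ne
    · exact ⟨_, h2⟩
  · exact ⟨_, h1⟩

theorem IsQuiet.mono {out out' : V → Set V} {r r' : V → ℕ} (h : ∀ v, out v ⊆ out' v) {v : V}
    (hq : IsQuiet (world C S out r) v) : IsQuiet (world C S out' r') v :=
  fun a ha b hb hu => hq a ha b hb (hu.mono h)

end Graph

section MaxDegree

variable {V : Type} [Fintype V] {C S : SimpleGraph V} {out : V → Set V} {r : V → ℕ}

theorem ncard_neighborSet_le_maxDeg (S : SimpleGraph V) (v : V) :
    (S.neighborSet v).ncard ≤ maxDeg S :=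
  Finset.le_sup (f := fun v => (S.neighborSet v).ncard) (Finset.mem_univ v)

theorem two_pow_le_maxDeg {v : V} {i : ℕ} (h : (core (world C S out r) v i).Nonempty) :
    2 ^ i ≤ maxDeg S := by
  obtain ⟨u, T, hT, hu⟩ := h
  refine (hT.2 u hu).trans (le_trans ?_ (ncard_neighborSet_le_maxDeg S v))
  refine le_trans ?_ (Set.ncard_le_ncard hT.1 (Set.toFinite _))
  -- the leaf itself is not among its uncovered neighbours, which makes up for the centre
  have hsub : {b | b ∈ insert v T ∧ Uncovered (world C S out r) u b} ⊆ insert v T \ {u} :=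
    fun b hb => ⟨hb.1, fun h => hb.2.ne h.symm⟩
  refine (Set.ncard_le_ncard hsub (Set.toFinite _)).trans ?_
  rw [Set.ncard_sdiff_singleton_of_mem (Set.mem_insert_of_mem v hu)]
  have := Set.ncard_insert_le v T
  omega

theorem lt_levels {v : V} {i : ℕ} (h : (core (world C S out r) v i).Nonempty) :
    i < Nat.log 2 (maxDeg S) + 1 := by
  have h2 := two_pow_le_maxDeg h
  exact Nat.lt_succ_of_le (Nat.le_log_of_pow_le (by norm_num) h2)

end MaxDegree

/-! ### Two-hop coverage -/

theorem covers_two_iff {V : Type} {H : SimpleGraph V} {a b : V} :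
    Covers 2 H a b ↔ ∃ w, a ∈ insert w (H.neighborSet w) ∧ b ∈ insert w (H.neighborSet w) := by
  classical
  constructor
  · rintro ⟨p, -, hp⟩
    match p, hp with
    | .nil, _ => exact ⟨a, Or.inl rfl, Or.inl rfl⟩
    | .cons h .nil, _ => exact ⟨a, Or.inl rfl, Or.inr h⟩
    | .cons (v := w) h (.cons h' .nil), _ => exact ⟨w, Or.inr h.symm, Or.inr h'⟩
    | .cons _ (.cons _ (.cons _ q)), hp => simp at hp
  · rintro ⟨w, ha, hb⟩
    have : ∃ p : H.Walk a b, p.length ≤ 2 := by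
      rcases ha with rfl | ha <;> rcases hb with rfl | hb
      · exact ⟨.nil, by simp⟩
      · exact ⟨(show H.Adj a b from hb).toWalk, by simp⟩
      · exact ⟨(show H.Adj b a from ha).symm.toWalk, by simp⟩
      · exact ⟨(show H.Adj w a from ha).symm.toWalk.append (show H.Adj w b from hb).toWalk, by simp⟩
    obtain ⟨p, hp⟩ := this
    exact ⟨p.bypass, p.bypass_isPath, p.length_bypass_le_length.trans hp⟩

/-! ### Guaranteed approximation: prices -/

section Price

variable {V : Type} [Fintype V] {C S : SimpleGraph V} {out : V → Set V} {r : V → ℕ}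

/-- The ordered client pairs. -/
noncomputable def clientPairs (C : SimpleGraph V) : Finset (V × V) :=
  (Set.toFinite {p : V × V | C.Adj p.1 p.2}).toFinset

/-- The ordered client pairs that are not covered yet. -/
noncomputable def uncoveredPairs (C S : SimpleGraph V) (out : V → Set V) : Finset (V × V) :=
  (Set.toFinite {p : V × V | Uncovered (world C S out 0) p.1 p.2}).toFinset

theorem mem_clientPairs {p : V × V} : p ∈ clientPairs C ↔ C.Adj p.1 p.2 := by
  simp [clientPairs]

theorem mem_uncoveredPairs {p : V × V} (r : V → ℕ) :
    p ∈ uncoveredPairs C S out ↔ Uncovered (world C S out r) p.1 p.2 := by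
  simp only [uncoveredPairs, Set.Finite.mem_toFinset]
  exact Iff.rfl

theorem uncoveredPairs_subset_clientPairs : uncoveredPairs C S out ⊆ clientPairs C := fun _ hp =>
  mem_clientPairs.2 ((mem_uncoveredPairs 0).1 hp).1

theorem uncoveredPairs_anti {out' : V → Set V} (h : ∀ v, out v ⊆ out' v) :
    uncoveredPairs C S out' ⊆ uncoveredPairs C S out := fun _ hp =>
  (mem_uncoveredPairs 0).2 (((mem_uncoveredPairs 0).1 hp).mono h)

/-- An upper bound for the price of a pair in a star with `k` leaves, at a moment when `j` other
pairs of this star are uncovered. -/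
noncomputable def starPrice (k j : ℕ) : ℝ := min 8 (32 * k / (j + 1))

theorem starPrice_nonneg (k j : ℕ) : 0 ≤ starPrice k j := le_min (by norm_num) (by positivity)

theorem starPrice_anti (k : ℕ) {i j : ℕ} (h : i ≤ j) : starPrice k j ≤ starPrice k i := by
  unfold starPrice
  gcongr

open Classical in
/-- A distribution of the cost of the bought stars over the covered pairs. The condition on a
competing star `T` at `w` is the one of the greedy set cover analysis: the pairs of the star that
are covered already have paid as if they had been covered one at a time, each at a price inversely
proportional to the number of pairs of the star that were still uncovered. -/
structure Priced (C S : SimpleGraph V) (out : V → Set V) (price : V × V → ℝ) : Prop where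
  total : ∑ v, ((out v).ncard : ℝ) ≤ ∑ p ∈ clientPairs C \ uncoveredPairs C S out, price p
  star : ∀ (w : V) (T : Set V) (D : Finset (V × V)), T ⊆ S.neighborSet w →
    (∀ p ∈ D, C.Adj p.1 p.2 ∧ p.1 ∈ insert w T ∧ p.2 ∈ insert w T) →
    ∑ p ∈ D \ uncoveredPairs C S out, price p ≤
      ∑ j ∈ Finset.Ico (D ∩ uncoveredPairs C S out).card D.card, starPrice T.ncard j

theorem priced_empty : Priced C S (fun _ => ∅) 0 where
  total := by simp
  star := by
    intro w T D _ _
    simp only [Pi.zero_apply, Finset.sum_const_zero]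
    exact Finset.sum_nonneg fun j _ => starPrice_nonneg _ _

open Classical in
/-- The stars bought in one iteration, each with its level. -/
noncomputable def chosenStars (C S : SimpleGraph V) (out : V → Set V) (r : V → ℕ) :
    Finset (V × ℕ) :=
  (Finset.univ ×ˢ Finset.range (Nat.log 2 (maxDeg S) + 1)).filter fun x =>
    IsChosen (world C S out r) x.1 x.2

theorem mem_chosenStars {x : V × ℕ} :
    x ∈ chosenStars C S out r ↔ IsChosen (world C S out r) x.1 x.2 := by
  simp only [chosenStars, Finset.mem_filter, Finset.mem_product, Finset.mem_univ, true_and,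
    Finset.mem_range, and_iff_right_iff_imp]
  exact fun h => lt_levels h.1.1

open Classical in
/-- The price that a pair pays in one iteration: a bought star of level `i` charges `8 / 2 ^ i` to
each of its voters. -/
noncomputable def votePrice (C S : SimpleGraph V) (out : V → Set V) (r : V → ℕ) (p : V × V) : ℝ :=
  ∑ x ∈ chosenStars C S out r, if p ∈ votes (world C S out r) x.1 x.2 then 8 / 2 ^ x.2 else 0

theorem votePrice_eq {x : V × ℕ} {p : V × V} (hx : x ∈ chosenStars C S out r)
    (hp : p ∈ votes (world C S out r) x.1 x.2) : votePrice C S out r p = 8 / 2 ^ x.2 := by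
  unfold votePrice
  rw [Finset.sum_eq_single_of_mem x hx, if_pos hp]
  intro y hy hyx
  rw [if_neg]
  intro hpy
  exact hyx (votes_unique (mem_chosenStars.1 hy).1 (mem_chosenStars.1 hx).1 hpy hp)

theorem exists_of_votePrice_ne_zero {p : V × V} (h : votePrice C S out r p ≠ 0) :
    ∃ x ∈ chosenStars C S out r, p ∈ votes (world C S out r) x.1 x.2 := by
  obtain ⟨x, hx, hne⟩ := Finset.exists_ne_zero_of_sum_ne_zero h
  refine ⟨x, hx, ?_⟩
  by_contra hp
  exact hne (if_neg hp)

open Classical in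
/-- The price paid in one iteration is a greedy price for every competing star: the centre of the
competing star is near the bought one, hence has no core at a higher level. -/
theorem votePrice_le_starPrice (hout : ∀ v, out v ⊆ S.neighborSet v) {w : V} {T : Set V}
    {D : Finset (V × V)} (hT : T ⊆ S.neighborSet w)
    (hD : ∀ p ∈ D, C.Adj p.1 p.2 ∧ p.1 ∈ insert w T ∧ p.2 ∈ insert w T)
    {p : V × V} (hp : p ∈ D ∩ uncoveredPairs C S out) :
    votePrice C S out r p ≤ starPrice T.ncard ((D ∩ uncoveredPairs C S out).card - 1) := by
  by_cases h0 : votePrice C S out r p = 0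
  · rw [h0]; exact starPrice_nonneg _ _
  obtain ⟨⟨v, i⟩, hx, hvote⟩ := exists_of_votePrice_ne_zero h0
  rw [votePrice_eq hx hvote]
  have hpos : 0 < (D ∩ uncoveredPairs C S out).card := Finset.card_pos.2 ⟨p, hp⟩
  have hch := mem_chosenStars.1 hx
  have hpD := hD p (Finset.mem_inter.1 hp).1
  have hw : w ∈ nearby (world C S out r) v :=
    ⟨p.1, insert_core_subset_hub v i hvote.1.1,
      hub_symm (Set.insert_subset_insert hT hpD.2.1 : p.1 ∈ hub (world C S out r) w)⟩
  have hle := ncard_uncovered_le_of_core_empty hout (hch.1.2 w hw (i + 1) (Nat.lt_succ_self i)) T hT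
  have hcard : (D ∩ uncoveredPairs C S out).card ≤ 2 * 2 ^ (i + 1) * T.ncard := by
    refine le_trans ?_ hle
    rw [← Set.ncard_coe_finset]
    refine Set.ncard_le_ncard (fun q hq => ?_) (Set.toFinite _)
    have hq := Finset.mem_inter.1 (Finset.mem_coe.1 hq)
    exact ⟨(hD q hq.1).2.1, (hD q hq.1).2.2, (mem_uncoveredPairs r).1 hq.2⟩
  set m := (D ∩ uncoveredPairs C S out).card with hm
  have hm1 : ((m - 1 : ℕ) : ℝ) + 1 = m := by
    rw [Nat.cast_sub hpos]; push_cast; ring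
  have hmpos : (0 : ℝ) < m := by exact_mod_cast hpos
  refine le_min ?_ ?_
  · exact div_le_self (by norm_num) (one_le_pow₀ (by norm_num))
  · rw [hm1, div_le_div_iff₀ (by positivity) hmpos]
    have : (m : ℝ) ≤ 2 * 2 ^ (i + 1) * T.ncard := by exact_mod_cast hcard
    calc (8 : ℝ) * m ≤ 8 * (2 * 2 ^ (i + 1) * T.ncard) := by gcongr
      _ = 32 * T.ncard * 2 ^ i := by ring

theorem ncard_nextBought_le [DecidableEq V] (v : V) : (nextBought (world C S out r) v).ncard ≤
    (out v).ncard + ∑ x ∈ chosenStars C S out r with x.1 = v,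
      (core (world C S out r) x.1 x.2).ncard := by
  by_cases h : ∃ i, IsChosen (world C S out r) v i
  · obtain ⟨i, hi⟩ := h
    have hset : nextBought (world C S out r) v = out v ∪ core (world C S out r) v i := by
      refine congrArg (out v ∪ ·) (Set.Subset.antisymm ?_ fun u hu => ⟨i, hi, hu⟩)
      rintro u ⟨j, hj, hu⟩
      rwa [← hj.1.level_unique hi.1]
    rw [hset]
    refine (Set.ncard_union_le _ _).trans (Nat.add_le_add_left ?_ _)
    have hmem : (v, i) ∈ (chosenStars C S out r).filter fun x => x.1 = v :=
      Finset.mem_filter.2 ⟨mem_chosenStars.2 hi, rfl⟩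
    exact Finset.single_le_sum (f := fun x : V × ℕ => (core (world C S out r) x.1 x.2).ncard)
      (fun _ _ => Nat.zero_le _) hmem
  · have hset : nextBought (world C S out r) v = out v := by
      refine Set.Subset.antisymm ?_ (subset_nextBought v)
      rintro u (hu | ⟨i, hi, -⟩)
      · exact hu
      · exact absurd ⟨i, hi⟩ h
    rw [hset]
    exact Nat.le_add_right _ _

theorem ncard_core_le_of_isChosen {x : V × ℕ} (hx : x ∈ chosenStars C S out r) :
    ((core (world C S out r) x.1 x.2).ncard : ℝ) ≤
      (votes (world C S out r) x.1 x.2).ncard * (8 / 2 ^ x.2) := by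
  have h1 := two_pow_mul_ncard_core_le (world C S out r) x.1 x.2
  have h2 := (mem_chosenStars.1 hx).2
  rw [mul_div_assoc', le_div_iff₀ (by positivity)]
  have h3 : (core (world C S out r) x.1 x.2).ncard * 2 ^ x.2 ≤
      (votes (world C S out r) x.1 x.2).ncard * 8 := by linarith
  exact_mod_cast h3

open Classical in
theorem sum_ncard_core_le :
    ∑ x ∈ chosenStars C S out r, ((core (world C S out r) x.1 x.2).ncard : ℝ) ≤
      ∑ p ∈ uncoveredPairs C S out \ uncoveredPairs C S (nextBought (world C S out r)),
        votePrice C S out r p := by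
  unfold votePrice
  rw [Finset.sum_comm]
  refine Finset.sum_le_sum fun x hx => (ncard_core_le_of_isChosen hx).trans ?_
  rw [← Finset.sum_filter, Finset.sum_const, nsmul_eq_mul]
  refine mul_le_mul_of_nonneg_right ?_ (by positivity)
  rw [← Set.ncard_coe_finset, Nat.cast_le]
  refine Set.ncard_le_ncard (fun p hp => ?_) (Set.toFinite _)
  simp only [Finset.coe_filter, Finset.mem_sdiff, Set.mem_ofPred_eq, mem_uncoveredPairs r]
  exact ⟨⟨hp.1.2.2, not_uncovered_of_isChosen (mem_chosenStars.1 hx) hp.1⟩, hp⟩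

/-- Prices can be maintained through one iteration, whatever the random numbers. -/
theorem Priced.next {price : V × V → ℝ} (hout : ∀ v, out v ⊆ S.neighborSet v)
    (h : Priced C S out price) (r : V → ℕ) :
    ∃ price', Priced C S (nextBought (world C S out r)) price' := by
  classical
  set out' := nextBought (world C S out r) with hout'
  set U := uncoveredPairs C S out with hU
  set U' := uncoveredPairs C S out' with hU'
  have hsub : U' ⊆ U := uncoveredPairs_anti fun v => subset_nextBought v
  refine ⟨fun p => if p ∈ U then votePrice C S out r p else price p, ?_, ?_⟩
  · have hsplit : clientPairs C \ U' = (clientPairs C \ U) ∪ (U \ U') := by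
      have := uncoveredPairs_subset_clientPairs (C := C) (S := S) (out := out)
      ext p
      simp only [Finset.mem_sdiff, Finset.mem_union]
      have h1 := @this p
      have h2 := @hsub p
      tauto
    have hdis : Disjoint (clientPairs C \ U) (U \ U') :=
      Finset.disjoint_of_subset_right Finset.sdiff_subset Finset.sdiff_disjoint
    rw [← hU', hsplit, Finset.sum_union hdis]
    have h1 : ∑ p ∈ clientPairs C \ U, (if p ∈ U then votePrice C S out r p else price p) =
        ∑ p ∈ clientPairs C \ U, price p :=
      Finset.sum_congr rfl fun p hp => if_neg (Finset.mem_sdiff.1 hp).2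
    have h2 : ∑ p ∈ U \ U', (if p ∈ U then votePrice C S out r p else price p) =
        ∑ p ∈ U \ U', votePrice C S out r p :=
      Finset.sum_congr rfl fun p hp => if_pos (Finset.mem_sdiff.1 hp).1
    rw [h1, h2]
    calc ∑ v, ((out' v).ncard : ℝ)
        ≤ ∑ v, (((out v).ncard : ℝ) + ∑ x ∈ chosenStars C S out r with x.1 = v,
            ((core (world C S out r) x.1 x.2).ncard : ℝ)) := by
          refine Finset.sum_le_sum fun v _ => ?_
          exact_mod_cast ncard_nextBought_le (C := C) (S := S) (out := out) (r := r) v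
      _ = ∑ v, ((out v).ncard : ℝ) +
            ∑ x ∈ chosenStars C S out r, ((core (world C S out r) x.1 x.2).ncard : ℝ) := by
          rw [Finset.sum_add_distrib]
          exact congrArg _ (Finset.sum_fiberwise _ Prod.fst _)
      _ ≤ _ := add_le_add h.total sum_ncard_core_le
  · intro w T D hT hD
    rw [← hU']
    have hsplit : D \ U' = (D \ U) ∪ ((D ∩ U) \ U') := by
      ext p
      simp only [Finset.mem_sdiff, Finset.mem_union, Finset.mem_inter]
      have h2 := @hsub p
      tauto
    have hdis : Disjoint (D \ U) ((D ∩ U) \ U') :=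
      Finset.disjoint_of_subset_right (Finset.sdiff_subset.trans Finset.inter_subset_right)
        Finset.sdiff_disjoint
    rw [hsplit, Finset.sum_union hdis]
    have h1 : ∑ p ∈ D \ U, (if p ∈ U then votePrice C S out r p else price p) =
        ∑ p ∈ D \ U, price p :=
      Finset.sum_congr rfl fun p hp => if_neg (Finset.mem_sdiff.1 hp).2
    have hcap : (D ∩ U) \ U' = (D ∩ U) \ (D ∩ U') := by
      ext p
      simp only [Finset.mem_sdiff, Finset.mem_inter]
      tauto
    have hle : D ∩ U' ⊆ D ∩ U := Finset.inter_subset_inter_left hsub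
    have h2 : ∑ p ∈ (D ∩ U) \ U', (if p ∈ U then votePrice C S out r p else price p) ≤
        ∑ j ∈ Finset.Ico (D ∩ U').card (D ∩ U).card, starPrice T.ncard j := by
      calc _ ≤ ∑ p ∈ (D ∩ U) \ U', starPrice T.ncard ((D ∩ U).card - 1) := by
            refine Finset.sum_le_sum fun p hp => ?_
            have hp' := (Finset.mem_sdiff.1 hp).1
            rw [if_pos (Finset.mem_inter.1 hp').2]
            exact votePrice_le_starPrice hout hT hD hp'
        _ = ∑ j ∈ Finset.Ico (D ∩ U').card (D ∩ U).card,
              starPrice T.ncard ((D ∩ U).card - 1) := by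
            rw [Finset.sum_const, Finset.sum_const, hcap, Finset.card_sdiff_of_subset hle,
              Nat.card_Ico]
        _ ≤ _ := by
            refine Finset.sum_le_sum fun j hj => starPrice_anti _ ?_
            have := (Finset.mem_Ico.1 hj).2
            omega
    have h3 := h.star w T D hT hD
    rw [← hU] at h3
    rw [h1]
    refine (add_le_add h3 h2).trans (le_of_eq ?_)
    rw [add_comm, Finset.sum_Ico_consecutive _ (Finset.card_le_card hle)
      (Finset.card_le_card Finset.inter_subset_left)]

end Price

/-! ### Guaranteed approximation: comparison with a solution -/

theorem max_zero_log_le {x q : ℝ} (hx : 0 ≤ x) (hq : 1 ≤ q) :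
    max 0 (Real.log x) ≤ x / q + Real.log q := by
  have hq0 : 0 < q := by linarith
  have hlq : 0 ≤ Real.log q := Real.log_nonneg hq
  refine max_le (by positivity) ?_
  rcases hx.eq_or_lt with rfl | hx
  · simpa using hlq
  · have := Real.log_le_sub_one_of_pos (div_pos hx hq0)
    rw [Real.log_div hx.ne' hq0.ne'] at this
    linarith

/-- The harmonic sum of the greedy analysis. -/
theorem sum_starPrice_le (k l : ℕ) :
    ∑ j ∈ Finset.range l, starPrice k j ≤ 8 * k + 32 * (k * max 0 (Real.log (l / k))) := by
  rcases Nat.eq_zero_or_pos k with rfl | hk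
  · simp [starPrice]
  have hk' : (0 : ℝ) < k := by exact_mod_cast hk
  rcases le_total l k with hlk | hkl
  · calc ∑ j ∈ Finset.range l, starPrice k j ≤ ∑ j ∈ Finset.range l, (8 : ℝ) :=
          Finset.sum_le_sum fun j _ => min_le_left _ _
      _ = 8 * l := by rw [Finset.sum_const, Finset.card_range, nsmul_eq_mul]; ring
      _ ≤ 8 * k := by gcongr
      _ ≤ _ := le_add_of_nonneg_right (by positivity)
  · have key : ∑ j ∈ Finset.range l, starPrice k j ≤ 8 * k + 32 * (k * Real.log (l / k)) := by
      induction l, hkl using Nat.le_induction with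
      | base =>
        rw [div_self hk'.ne', Real.log_one]
        calc ∑ j ∈ Finset.range k, starPrice k j ≤ ∑ j ∈ Finset.range k, (8 : ℝ) :=
              Finset.sum_le_sum fun j _ => min_le_left _ _
          _ = 8 * k + 32 * (k * 0) := by
              rw [Finset.sum_const, Finset.card_range, nsmul_eq_mul]; ring
      | succ l hl ih =>
        rw [Finset.sum_range_succ]
        have hl' : (0 : ℝ) < l := hk'.trans_le (by exact_mod_cast hl)
        -- the increment of the logarithm from `l` to `l + 1` is at least `1 / (l + 1)`
        have hlog : 1 / ((l : ℝ) + 1) ≤ Real.log ((l + 1 : ℕ) / k) - Real.log (l / k) := by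
          push_cast
          rw [← Real.log_div (by positivity) (by positivity)]
          have h := Real.one_sub_inv_le_log_of_pos (x := ((l : ℝ) + 1) / k / (l / k))
            (by positivity)
          refine le_trans (le_of_eq ?_) h
          field_simp
          ring
        have hstar : starPrice k l ≤ 32 * (k * (1 / ((l : ℝ) + 1))) :=
          (min_le_right _ _).trans (le_of_eq (by ring))
        have hmul := mul_le_mul_of_nonneg_left hlog hk'.le
        rw [mul_sub] at hmul
        linarith
    refine key.trans ?_
    gcongr
    exact le_max_right _ _

section Compare

variable {V : Type} [Fintype V] {C S : SimpleGraph V} {out : V → Set V}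

theorem sum_ncard_neighborSet (H : SimpleGraph V) :
    ∑ v, (H.neighborSet v).ncard = 2 * edgeCount H := by
  classical
  rw [edgeCount, Set.ncard_eq_toFinset_card' H.edgeSet]
  have := H.sum_degrees_eq_twice_card_edges
  rw [SimpleGraph.edgeFinset] at this
  rw [← this]
  refine Finset.sum_congr rfl fun v _ => ?_
  rw [Set.ncard_eq_toFinset_card']
  rfl

theorem card_clientPairs (C : SimpleGraph V) : (clientPairs C).card = 2 * edgeCount C := by
  classical
  rw [← sum_ncard_neighborSet,
    Finset.card_eq_sum_card_fiberwise (f := Prod.fst) (t := Finset.univ) (fun _ _ => by simp)]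
  refine Finset.sum_congr rfl fun v _ => ?_
  rw [← Set.ncard_image_of_injective _ (Prod.mk_right_injective v), ← Set.ncard_coe_finset]
  congr 1
  ext p
  simp only [Finset.coe_filter, mem_clientPairs, Set.mem_ofPred_eq, Set.mem_image]
  constructor
  · rintro ⟨h, rfl⟩; exact ⟨p.2, h, rfl⟩
  · rintro ⟨b, h, rfl⟩; exact ⟨h, rfl⟩

theorem touchedCount_le {H : SimpleGraph V} (hH : IsClientServerSpanner 2 C S H) :
    touchedCount C ≤ 2 * edgeCount H := by
  classical
  rw [← sum_ncard_neighborSet, touchedCount, Set.ncard_eq_toFinset_card', Finset.card_eq_sum_ones]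
  refine (Finset.sum_le_sum fun a ha => ?_).trans
    (Finset.sum_le_sum_of_subset (Finset.subset_univ _))
  obtain ⟨b, hab⟩ := (SimpleGraph.mem_support C).1 (Set.mem_toFinset.1 ha)
  obtain ⟨w, hwa, hwb⟩ := covers_two_iff.1 (hH.2 a b hab)
  refine (Set.ncard_pos (Set.toFinite _)).2 ?_
  rcases hwa with rfl | hwa
  · exact ⟨b, hwb.resolve_left (C.ne_of_adj hab).symm⟩
  · exact ⟨w, SimpleGraph.Adj.symm hwa⟩

/-- The cost is bounded for every choice of a threshold `q` on the average number of client pairs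
per leaf in the stars of the solution `H`. -/
theorem Priced.sum_ncard_le {price : V × V → ℝ} (h : Priced C S out price)
    (hU : uncoveredPairs C S out = ∅) {H : SimpleGraph V} (hH : IsClientServerSpanner 2 C S H)
    {q : ℝ} (hq : 1 ≤ q)
    (hbound : (edgeCount C : ℝ) ≤ q * touchedCount C ∨ (maxDeg S : ℝ) ≤ q) :
    ∑ v, ((out v).ncard : ℝ) ≤ 208 * max 1 (Real.log q) * edgeCount H := by
  classical
  have hcen : ∀ p : V × V, ∃ w, C.Adj p.1 p.2 →
      p.1 ∈ insert w (H.neighborSet w) ∧ p.2 ∈ insert w (H.neighborSet w) := fun p => by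
    by_cases hp : C.Adj p.1 p.2
    · obtain ⟨w, hw⟩ := covers_two_iff.1 (hH.2 _ _ hp)
      exact ⟨w, fun _ => hw⟩
    · exact ⟨p.1, fun h => absurd h hp⟩
  choose cen hcen using hcen
  set D : V → Finset (V × V) := fun w => (clientPairs C).filter fun p => cen p = w with hD
  have hDmem : ∀ w, ∀ p ∈ D w, C.Adj p.1 p.2 ∧ p.1 ∈ insert w (H.neighborSet w) ∧
      p.2 ∈ insert w (H.neighborSet w) := by
    intro w p hp
    obtain ⟨h1, rfl⟩ := Finset.mem_filter.1 hp
    exact ⟨mem_clientPairs.1 h1, hcen p (mem_clientPairs.1 h1)⟩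
  set k : V → ℕ := fun w => (H.neighborSet w).ncard with hk
  have hHS : ∀ w, H.neighborSet w ⊆ S.neighborSet w := fun w x hx => hH.1 hx
  have hksum : ∑ w, (k w : ℝ) = 2 * edgeCount H := by exact_mod_cast sum_ncard_neighborSet H
  have hDsum : ∑ w, (D w).card = (clientPairs C).card :=
    (Finset.card_eq_sum_card_fiberwise (f := cen) (t := Finset.univ) (fun _ _ => by simp)).symm
  have hq0 : 0 < q := by linarith
  have hl : ((clientPairs C).card : ℝ) / q ≤ 4 * edgeCount H := by
    rw [div_le_iff₀ hq0]
    rcases hbound with hb | hb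
    · have h1 : ((clientPairs C).card : ℝ) = 2 * edgeCount C := by
        exact_mod_cast card_clientPairs C
      have h2 : (touchedCount C : ℝ) ≤ 2 * edgeCount H := by exact_mod_cast touchedCount_le hH
      have h3 := mul_le_mul_of_nonneg_left h2 hq0.le
      rw [h1]
      linarith
    · rw [← hDsum, Nat.cast_sum]
      calc ∑ w, ((D w).card : ℝ) ≤ ∑ w, 2 * q * (k w : ℝ) := by
            refine Finset.sum_le_sum fun w _ => ?_
            have hsub : D w ⊆ (insert w (H.neighborSet w)).toFinset.offDiag := fun p hp => by
              have := hDmem w p hp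
              simp only [Finset.mem_offDiag, Set.mem_toFinset]
              exact ⟨this.2.1, this.2.2, C.ne_of_adj this.1⟩
            have h1 := Finset.card_le_card hsub
            rw [Finset.offDiag_card, ← Set.ncard_eq_toFinset_card'] at h1
            have h2 : (insert w (H.neighborSet w)).ncard = k w + 1 :=
              Set.ncard_insert_of_notMem (H.notMem_neighborSet_self) (Set.toFinite _)
            rw [h2] at h1
            have h3 : (k w + 1) * (k w + 1) - (k w + 1) = (k w + 1) * k w := by
              rw [← Nat.mul_sub_one]; rfl
            have h4 : ((D w).card : ℝ) ≤ (k w + 1) * k w := by exact_mod_cast h3 ▸ h1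
            rcases Nat.eq_zero_or_pos (k w) with h0 | h0
            · rw [h0] at h4 ⊢
              simpa using h4
            · have h5 : (k w : ℝ) ≤ q := le_trans (by
                exact_mod_cast (Set.ncard_le_ncard (hHS w) (Set.toFinite _)).trans
                  (ncard_neighborSet_le_maxDeg S w)) hb
              refine h4.trans (mul_le_mul_of_nonneg_right ?_ (Nat.cast_nonneg _))
              linarith
        _ = 4 * edgeCount H * q := by rw [← Finset.mul_sum, hksum]; ring
  have hprice : ∑ p ∈ clientPairs C, price p ≤
      ∑ w, (8 * (k w : ℝ) + 32 * ((D w).card / q + k w * Real.log q)) := by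
    rw [← Finset.sum_fiberwise (clientPairs C) cen price]
    refine Finset.sum_le_sum fun w _ => ?_
    have h1 := h.star w (H.neighborSet w) (D w) (hHS w) (hDmem w)
    rw [hU, Finset.sdiff_empty, Finset.inter_empty, Finset.card_empty,
      ← Finset.range_eq_Ico] at h1
    refine h1.trans ((sum_starPrice_le _ _).trans ?_)
    refine add_le_add le_rfl (mul_le_mul_of_nonneg_left ?_ (by norm_num))
    rcases Nat.eq_zero_or_pos (k w) with h0 | h0
    · change (k w : ℝ) * _ ≤ _
      rw [h0]
      simp only [Nat.cast_zero, zero_mul, add_zero]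
      positivity
    · have h0' : (0 : ℝ) < k w := by exact_mod_cast h0
      refine (mul_le_mul_of_nonneg_left
        (max_zero_log_le (x := (D w).card / (k w : ℝ)) (by positivity) hq) h0'.le).trans ?_
      rw [mul_add]
      refine add_le_add (le_of_eq ?_) le_rfl
      field_simp
  have htot := h.total
  rw [hU, Finset.sdiff_empty] at htot
  refine (htot.trans hprice).trans ?_
  rw [Finset.sum_add_distrib, ← Finset.mul_sum, ← Finset.mul_sum, Finset.sum_add_distrib,
    ← Finset.sum_mul, hksum, ← Finset.sum_div, ← Nat.cast_sum, hDsum]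
  have hh : (0 : ℝ) ≤ edgeCount H := Nat.cast_nonneg _
  have h1 := mul_le_mul_of_nonneg_right (le_max_left 1 (Real.log q)) hh
  have h2 := mul_le_mul_of_nonneg_right (le_max_right 1 (Real.log q)) hh
  linarith

theorem Priced.approximation {price : V × V → ℝ} (h : Priced C S out price)
    (hU : uncoveredPairs C S out = ∅) {H : SimpleGraph V} (hH : IsClientServerSpanner 2 C S H) :
    ∑ v, ((out v).ncard : ℝ) ≤ 208 * max 1 (min (Real.log ((edgeCount C : ℝ) / touchedCount C))
      (Real.log (maxDeg S))) * edgeCount H := by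
  rcases min_choice (Real.log ((edgeCount C : ℝ) / touchedCount C)) (Real.log (maxDeg S))
    with hm | hm
  · rw [hm]
    have hlog : max 1 (Real.log (max 1 ((edgeCount C : ℝ) / touchedCount C))) =
        max 1 (Real.log ((edgeCount C : ℝ) / touchedCount C)) := by
      rcases le_total ((edgeCount C : ℝ) / touchedCount C) 1 with h1 | h1
      · rw [max_eq_left h1, Real.log_one, max_eq_left zero_le_one, max_eq_left]
        exact (Real.log_nonpos (by positivity) h1).trans zero_le_one
      · rw [max_eq_right h1]
    rw [← hlog]
    refine h.sum_ncard_le hU hH (le_max_left _ _) (Or.inl ?_)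
    rcases Nat.eq_zero_or_pos (touchedCount C) with h0 | h0
    · -- without touched vertices there are no client edges
      have h1 : C.support = ∅ := (Set.ncard_eq_zero (Set.toFinite _)).1 h0
      have h2 : C.edgeSet = ∅ := by
        rw [C.support_eq_bot_iff.1 h1, SimpleGraph.edgeSet_bot]
      rw [edgeCount, h2, h0]
      simp
    · have h0' : (0 : ℝ) < touchedCount C := by exact_mod_cast h0
      rw [← div_le_iff₀ h0']
      exact le_max_right _ _
  · rw [hm]
    have hlog : Real.log (max 1 (maxDeg S : ℝ)) = Real.log (maxDeg S) := by
      rcases Nat.eq_zero_or_pos (maxDeg S) with h0 | h0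
      · simp [h0]
      · rw [max_eq_right (by exact_mod_cast h0)]
    rw [← hlog]
    exact h.sum_ncard_le hU hH (le_max_left _ _) (Or.inr (le_max_right _ _))

end Compare

/-! ### Random symmetry breaking -/

section Draw

variable {V : Type} [Fintype V] [DecidableEq V] {R : ℕ}

/-- The outcomes in which `v` draws a strictly smaller number than all other elements of `A`. -/
def strictMin (R : ℕ) (A : Finset V) (v : V) : Finset (V → Fin (R + 1)) :=
  Finset.univ.filter fun r => ∀ w ∈ A, w ≠ v → r v < r w

theorem mem_strictMin {A : Finset V} {v : V} {r : V → Fin (R + 1)} :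
    r ∈ strictMin R A v ↔ ∀ w ∈ A, w ≠ v → r v < r w := by simp [strictMin]

theorem strictMin_union (A B : Finset V) (v : V) :
    strictMin R (A ∪ B) v = strictMin R A v ∩ strictMin R B v := by
  ext r
  simp only [Finset.mem_inter, mem_strictMin, Finset.mem_union]
  exact ⟨fun h => ⟨fun w hw => h w (Or.inl hw), fun w hw => h w (Or.inr hw)⟩,
    fun h w hw => hw.elim (h.1 w) (h.2 w)⟩

theorem card_strictMin_eq {A : Finset V} {u v : V} (hu : u ∈ A) (hv : v ∈ A) :
    (strictMin R A u).card = (strictMin R A v).card := by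
  have hswap : ∀ w, Equiv.swap u v w ∈ A ↔ w ∈ A := fun w => by
    rcases eq_or_ne w u with rfl | h1
    · simp [hu, hv]
    rcases eq_or_ne w v with rfl | h2
    · simp [hu, hv]
    · rw [Equiv.swap_apply_of_ne_of_ne h1 h2]
  refine Finset.card_bijective (fun r => r ∘ Equiv.swap u v)
    ((Equiv.swap u v).arrowCongr (Equiv.refl (Fin (R + 1)))).bijective fun r => ?_
  simp only [mem_strictMin, Function.comp_apply, Equiv.swap_apply_right]
  constructor
  · intro h w hw hne
    exact h _ ((hswap w).2 hw) fun h' => hne (by rw [Equiv.swap_apply_eq_iff] at h'; simpa using h')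
  · intro h w hw hne
    have := h (Equiv.swap u v w) ((hswap w).2 hw)
      fun h' => hne (by rw [Equiv.swap_apply_eq_iff] at h'; simpa using h')
    simpa using this

theorem strictMin_unique {A : Finset V} {u v : V} (hu : u ∈ A) (hv : v ∈ A)
    {r : V → Fin (R + 1)} (h1 : r ∈ strictMin R A u) (h2 : r ∈ strictMin R A v) : u = v := by
  by_contra h
  exact lt_asymm (mem_strictMin.1 h1 v hv (Ne.symm h)) (mem_strictMin.1 h2 u hu h)

theorem card_strictMin_mul_le {A : Finset V} {v : V} (hv : v ∈ A) :
    A.card * (strictMin R A v).card ≤ Fintype.card (V → Fin (R + 1)) := by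
  calc A.card * (strictMin R A v).card = ∑ u ∈ A, (strictMin R A u).card := by
        rw [Finset.sum_congr rfl fun u hu => card_strictMin_eq hu hv, Finset.sum_const, smul_eq_mul]
    _ = (A.biUnion fun u => strictMin R A u).card := by
        refine (Finset.card_biUnion fun u hu w hw huw => ?_).symm
        exact Finset.disjoint_left.2 fun r h1 h2 => huw (strictMin_unique hu hw h1 h2)
    _ ≤ _ := Finset.card_le_univ _

theorem card_tie_mul_le {u w : V} (h : u ≠ w) :
    (Finset.univ.filter fun r : V → Fin (R + 1) => r u = r w).card * (R + 1) ≤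
      Fintype.card (V → Fin (R + 1)) := by
  calc _ = ((Finset.univ.filter fun r : V → Fin (R + 1) => r u = r w) ×ˢ
        (Finset.univ : Finset (Fin (R + 1)))).card := by
        rw [Finset.card_product, Finset.card_univ, Fintype.card_fin]
    _ ≤ _ := by
        rw [← Finset.card_univ]
        -- overwriting the value at `u` loses nothing, since it is still present at `w`
        refine Finset.card_le_card_of_injOn (fun q => Function.update q.1 u q.2)
          (fun _ _ => Finset.mem_coe.2 (Finset.mem_univ _)) ?_
        rintro ⟨r, x⟩ hr ⟨s, y⟩ hs hrs
        simp only [Finset.coe_product, Finset.coe_filter, Finset.mem_univ, true_and,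
          Set.mem_prod, Set.mem_ofPred_eq, Finset.coe_univ, Set.mem_univ, and_true] at hr hs
        have hval : ∀ z, Function.update r u x z = Function.update s u y z := congrFun hrs
        have hne : ∀ z, z ≠ u → r z = s z := fun z hz => by
          simpa [Function.update_of_ne hz] using hval z
        refine Prod.ext (funext fun z => ?_) (by simpa using hval u)
        rcases eq_or_ne z u with rfl | hz
        · change r z = s z
          rw [hr, hs, hne w h.symm]
        · exact hne z hz

/-- With a large enough range, ties are unlikely, so `v` is a strict minimum with probability almost
`1 / |A|`. -/
theorem le_card_strictMin {A : Finset V} {v : V} (hv : v ∈ A)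
    (hR : 8 * Fintype.card V ^ 2 ≤ R + 1) :
    (7 / 8 : ℝ) * Fintype.card (V → Fin (R + 1)) ≤ A.card * (strictMin R A v).card := by
  set N := Fintype.card (V → Fin (R + 1)) with hN
  have hcover : (Finset.univ : Finset (V → Fin (R + 1))) ⊆ (A.biUnion fun u => strictMin R A u) ∪
      A.offDiag.biUnion fun q => Finset.univ.filter fun r => r q.1 = r q.2 := by
    intro r _
    obtain ⟨u, hu, hmin⟩ := Finset.exists_min_image A r ⟨v, hv⟩
    by_cases h : r ∈ strictMin R A u
    · exact Finset.mem_union_left _ (Finset.mem_biUnion.2 ⟨u, hu, h⟩)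
    · rw [mem_strictMin] at h
      push Not at h
      obtain ⟨w, hw, hne, hle⟩ := h
      refine Finset.mem_union_right _ (Finset.mem_biUnion.2
        ⟨(u, w), Finset.mem_offDiag.2 ⟨hu, hw, hne.symm⟩, ?_⟩)
      simpa using le_antisymm (hmin w hw) hle
  have h1 := (Finset.card_le_card hcover).trans (Finset.card_union_le _ _)
  rw [Finset.card_univ, ← hN] at h1
  have h2 : (A.biUnion fun u => strictMin R A u).card ≤ A.card * (strictMin R A v).card := by
    refine Finset.card_biUnion_le.trans (le_of_eq ?_)
    rw [Finset.sum_congr rfl fun u hu => card_strictMin_eq hu hv, Finset.sum_const, smul_eq_mul]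
  have h3 : ((A.offDiag.biUnion fun q => Finset.univ.filter
      fun r : V → Fin (R + 1) => r q.1 = r q.2).card : ℝ) ≤ N / 8 := by
    have hR' : (0 : ℝ) < (R : ℝ) + 1 := by positivity
    have h4 : ((A.offDiag.biUnion fun q => Finset.univ.filter
        fun r : V → Fin (R + 1) => r q.1 = r q.2).card : ℝ) ≤
        ∑ q ∈ A.offDiag, (N : ℝ) / (R + 1) := by
      refine (Nat.cast_le.2 Finset.card_biUnion_le).trans ?_
      rw [Nat.cast_sum]
      refine Finset.sum_le_sum fun q hq => ?_
      rw [le_div_iff₀ hR']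
      exact_mod_cast card_tie_mul_le (R := R) (Finset.mem_offDiag.1 hq).2.2
    refine h4.trans ?_
    rw [Finset.sum_const, nsmul_eq_mul]
    have h5 : (A.offDiag.card : ℝ) ≤ (Fintype.card V : ℝ) ^ 2 := by
      have : A.offDiag.card ≤ Fintype.card V ^ 2 := by
        rw [Finset.offDiag_card, sq]
        exact (Nat.sub_le _ _).trans
          (Nat.mul_le_mul (Finset.card_le_univ A) (Finset.card_le_univ A))
      exact_mod_cast this
    have h6 : 8 * (Fintype.card V : ℝ) ^ 2 ≤ R + 1 := by exact_mod_cast hR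
    have hN0 : (0 : ℝ) ≤ N := Nat.cast_nonneg _
    rw [mul_div_assoc', div_le_div_iff₀ hR' (by norm_num)]
    nlinarith
  have h1' : (N : ℝ) ≤ (A.biUnion fun u => strictMin R A u).card +
      (A.offDiag.biUnion fun q => Finset.univ.filter
        fun r : V → Fin (R + 1) => r q.1 = r q.2).card := by exact_mod_cast h1
  have h2' : ((A.biUnion fun u => strictMin R A u).card : ℝ) ≤
      A.card * (strictMin R A v).card := by exact_mod_cast h2
  linarith

end Draw

section Vote

variable {V E : Type} [Fintype V] [DecidableEq E] (K : V → Finset E) {R : ℕ}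

/-- The vertices that claim the element `e`. -/
def claimants (e : E) : Finset V := Finset.univ.filter fun v => e ∈ K v

variable {K}

theorem mem_claimants {e : E} {v : V} : v ∈ claimants K e ↔ e ∈ K v := by simp [claimants]

/-- For at least half of the claims `e` of `v`, at least half of the claims of `v` have at most as
many claimants as `e`. -/
theorem card_le_two_mul_card_good (v : V) :
    (K v).card ≤ 2 * ((K v).filter fun e => (K v).card ≤
      2 * ((K v).filter fun e' => (claimants K e').card ≤ (claimants K e).card).card).card := by
  set good : E → Prop := fun e => (K v).card ≤
      2 * ((K v).filter fun e' => (claimants K e').card ≤ (claimants K e).card).card with hgood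
  have hsum := Finset.card_filter_add_card_filter_not (s := K v) good
  have hbad : 2 * ((K v).filter fun e => ¬ good e).card ≤ (K v).card := by
    rcases ((K v).filter fun e => ¬ good e).eq_empty_or_nonempty with h | h
    · rw [h]; simp
    · -- the bad claims all have at most as many claimants as the worst of them
      obtain ⟨e, he, hmax⟩ := Finset.exists_max_image _ (fun e => (claimants K e).card) h
      have hsub : ((K v).filter fun e => ¬ good e) ⊆
          (K v).filter fun e' => (claimants K e').card ≤ (claimants K e).card := fun e' he' =>
        Finset.mem_filter.2 ⟨(Finset.mem_filter.1 he').1, hmax e' he'⟩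
      have h1 := Finset.card_le_card hsub
      have h2 := (Finset.mem_filter.1 he).2
      simp only [hgood, not_le] at h2
      omega
  have hle : (K v).card ≤ 2 * ((K v).filter good).card := by omega
  exact hle

variable [DecidableEq V]

variable (K) in
/-- The elements that vote for `v`. -/
def voters (r : V → Fin (R + 1)) (v : V) : Finset E :=
  (K v).filter fun e => r ∈ strictMin R (claimants K e) v

variable (K) in
/-- The elements that vote for a vertex with sufficiently many votes. -/
def winners (r : V → Fin (R + 1)) : Finset E :=
  (Finset.univ.filter fun v => (K v).card ≤ 8 * (voters K r v).card).biUnion (voters K r)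

/-- A good claim of `v` votes for `v`, and `v` gets enough votes, with probability at least a
quarter of the inverse number of its claimants: given the vote of `e`, every claim with at most as
many claimants votes for `v` with probability almost one half. -/
theorem le_card_vote_and_success (hR : 8 * Fintype.card V ^ 2 ≤ R + 1) {v : V} {e : E}
    (he : e ∈ K v) (hgood : (K v).card ≤
      2 * ((K v).filter fun e' => (claimants K e').card ≤ (claimants K e).card).card) :
    (Fintype.card (V → Fin (R + 1)) : ℝ) / 4 ≤ (claimants K e).card *
      (Finset.univ.filter fun r : V → Fin (R + 1) =>
        e ∈ voters K r v ∧ (K v).card ≤ 8 * (voters K r v).card).card := by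
  set N := Fintype.card (V → Fin (R + 1)) with hN
  set L := (K v).filter fun e' => (claimants K e').card ≤ (claimants K e).card with hL
  set d := (claimants K e).card with hd
  set P := Finset.univ.filter fun r : V → Fin (R + 1) =>
    e ∈ voters K r v ∧ (K v).card ≤ 8 * (voters K r v).card with hP
  set F := Finset.univ.filter fun r : V → Fin (R + 1) =>
    e ∈ voters K r v ∧ ¬ (K v).card ≤ 8 * (voters K r v).card with hF
  set M := strictMin R (claimants K e) v with hM
  have hvote : ∀ e' ∈ K v, ∀ r : V → Fin (R + 1),
      e' ∈ voters K r v ↔ r ∈ strictMin R (claimants K e') v := fun e' he' r => by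
    simp [voters, he']
  have hMPF : M.card = P.card + F.card := by
    have hMeq : M = Finset.univ.filter fun r : V → Fin (R + 1) => e ∈ voters K r v := by
      ext r
      simp [hM, hvote e he]
    rw [hMeq, ← Finset.card_filter_add_card_filter_not
      (s := Finset.univ.filter fun r : V → Fin (R + 1) => e ∈ voters K r v)
      (fun r => (K v).card ≤ 8 * (voters K r v).card), Finset.filter_filter, Finset.filter_filter]
  have hvA : v ∈ claimants K e := mem_claimants.2 he
  have hd0 : (0 : ℝ) < d := by exact_mod_cast Finset.card_pos.2 ⟨v, hvA⟩
  have heL : e ∈ L := Finset.mem_filter.2 ⟨he, le_rfl⟩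
  have hL0 : (0 : ℝ) < L.card := by exact_mod_cast Finset.card_pos.2 ⟨e, heL⟩
  -- the two votes for `v` coincide on a fraction of almost one half of the outcomes
  have hpair : ∀ e' ∈ L, ((M \ strictMin R (claimants K e') v).card : ℝ) ≤
      M.card - 7 / 16 * (N / d) := by
    intro e' he'
    obtain ⟨he'K, he'd⟩ := Finset.mem_filter.1 he'
    have h1 := le_card_strictMin (R := R) (Finset.mem_union_left (claimants K e') hvA) hR
    rw [strictMin_union, ← hM, ← hN] at h1
    have h2 : ((claimants K e ∪ claimants K e').card : ℝ) ≤ 2 * d := by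
      have := Finset.card_union_le (claimants K e) (claimants K e')
      have h3 : (claimants K e ∪ claimants K e').card ≤ 2 * d := by omega
      exact_mod_cast h3
    have h3 := Finset.card_sdiff_add_card_inter M (strictMin R (claimants K e') v)
    have h3' : ((M \ strictMin R (claimants K e') v).card : ℝ) +
        (M ∩ strictMin R (claimants K e') v).card = M.card := by exact_mod_cast h3
    have h4 : 7 / 16 * ((N : ℝ) / d) ≤ (M ∩ strictMin R (claimants K e') v).card := by
      rw [mul_div_assoc', div_le_iff₀ hd0]
      have := h1.trans (mul_le_mul_of_nonneg_right h2 (Nat.cast_nonneg _))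
      linarith
    linarith
  have hFle : 3 / 4 * (L.card : ℝ) * F.card ≤ L.card * (M.card - 7 / 16 * (N / d)) := by
    calc 3 / 4 * (L.card : ℝ) * F.card = ∑ r ∈ F, 3 / 4 * (L.card : ℝ) := by
          rw [Finset.sum_const, nsmul_eq_mul]; ring
      _ ≤ ∑ r ∈ F, ((L.filter fun e' => r ∉ strictMin R (claimants K e') v).card : ℝ) := by
          refine Finset.sum_le_sum fun r hr => ?_
          have h1 := (Finset.mem_filter.1 hr).2.2
          have h2 := Finset.card_filter_add_card_filter_not (s := L)
            (fun e' => r ∈ strictMin R (claimants K e') v)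
          have h3 : (L.filter fun e' => r ∈ strictMin R (claimants K e') v).card ≤
              (voters K r v).card :=
            Finset.card_le_card (Finset.filter_subset_filter _ (Finset.filter_subset _ _))
          have h4 : 3 * L.card ≤
              4 * (L.filter fun e' => r ∉ strictMin R (claimants K e') v).card := by omega
          have h4' : (3 : ℝ) * L.card ≤
              4 * (L.filter fun e' => r ∉ strictMin R (claimants K e') v).card := by
            exact_mod_cast h4
          linarith
      _ = ∑ e' ∈ L, ((F.filter fun r => r ∉ strictMin R (claimants K e') v).card : ℝ) := by
          simp only [Finset.card_filter, Nat.cast_sum]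
          exact Finset.sum_comm
      _ ≤ ∑ e' ∈ L, (M.card - 7 / 16 * ((N : ℝ) / d)) := by
          refine Finset.sum_le_sum fun e' he' => le_trans ?_ (hpair e' he')
          rw [Nat.cast_le]
          refine Finset.card_le_card fun r hr => ?_
          obtain ⟨hrF, hr'⟩ := Finset.mem_filter.1 hr
          exact Finset.mem_sdiff.2 ⟨(hvote e he r).1 (Finset.mem_filter.1 hrF).2.1, hr'⟩
      _ = _ := by rw [Finset.sum_const, nsmul_eq_mul]
  have hFle' : 3 / 4 * (F.card : ℝ) ≤ M.card - 7 / 16 * (N / d) := by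
    refine le_of_mul_le_mul_left ?_ hL0
    linarith
  have hMle : (M.card : ℝ) ≤ N / d := by
    rw [le_div_iff₀ hd0]
    have := card_strictMin_mul_le (R := R) hvA
    rw [mul_comm]
    exact_mod_cast this
  have hM' : (M.card : ℝ) = P.card + F.card := by exact_mod_cast hMPF
  have hfin : (N : ℝ) / d / 4 ≤ P.card := by linarith
  rw [mul_comm]
  rw [div_right_comm, div_le_iff₀ hd0] at hfin
  exact hfin

theorem voters_unique {r : V → Fin (R + 1)} {u v : V} {e : E} (hu : e ∈ voters K r u)
    (hv : e ∈ voters K r v) : u = v := by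
  obtain ⟨hu1, hu2⟩ := Finset.mem_filter.1 hu
  obtain ⟨hv1, hv2⟩ := Finset.mem_filter.1 hv
  exact strictMin_unique (mem_claimants.2 hu1) (mem_claimants.2 hv1) hu2 hv2

/-- On average over the random numbers, an eighth of all claims concern winning elements. -/
theorem le_sum_card_claims_inter_winners (hR : 8 * Fintype.card V ^ 2 ≤ R + 1) :
    (Fintype.card (V → Fin (R + 1)) : ℝ) / 8 * ∑ v, ((K v).card : ℝ) ≤
      ∑ r : V → Fin (R + 1), ∑ v, ((K v ∩ winners K r).card : ℝ) := by
  set N := Fintype.card (V → Fin (R + 1)) with hN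
  calc (N : ℝ) / 8 * ∑ v, ((K v).card : ℝ)
      ≤ ∑ v, ∑ e ∈ K v, ((claimants K e).card : ℝ) *
        (Finset.univ.filter fun r : V → Fin (R + 1) =>
          e ∈ voters K r v ∧ (K v).card ≤ 8 * (voters K r v).card).card := by
        rw [Finset.mul_sum]
        refine Finset.sum_le_sum fun v _ => ?_
        set G := (K v).filter fun e => (K v).card ≤
          2 * ((K v).filter fun e' => (claimants K e').card ≤ (claimants K e).card).card with hG
        have h1 : ((K v).card : ℝ) ≤ 2 * G.card := by
          exact_mod_cast card_le_two_mul_card_good (K := K) v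
        have hN0 : (0 : ℝ) ≤ N := Nat.cast_nonneg _
        calc (N : ℝ) / 8 * (K v).card ≤ N / 8 * (2 * G.card) := by gcongr
          _ = ∑ e ∈ G, (N : ℝ) / 4 := by rw [Finset.sum_const, nsmul_eq_mul]; ring
          _ ≤ ∑ e ∈ G, ((claimants K e).card : ℝ) *
              (Finset.univ.filter fun r : V → Fin (R + 1) =>
                e ∈ voters K r v ∧ (K v).card ≤ 8 * (voters K r v).card).card :=
              Finset.sum_le_sum fun e he => le_card_vote_and_success hR
                (Finset.mem_filter.1 he).1 (Finset.mem_filter.1 he).2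
          _ ≤ _ := Finset.sum_le_sum_of_subset_of_nonneg (Finset.filter_subset _ _)
              fun _ _ _ => by positivity
    _ = ∑ r : V → Fin (R + 1), ∑ v, ∑ e ∈ K v,
          if e ∈ voters K r v ∧ (K v).card ≤ 8 * (voters K r v).card
            then ((claimants K e).card : ℝ) else 0 := by
        rw [Finset.sum_comm]
        refine Finset.sum_congr rfl fun v _ => ?_
        rw [Finset.sum_comm]
        refine Finset.sum_congr rfl fun e _ => ?_
        rw [← Finset.sum_filter, Finset.sum_const, nsmul_eq_mul, mul_comm]
    _ = ∑ r : V → Fin (R + 1), ∑ e ∈ winners K r, ((claimants K e).card : ℝ) := by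
        refine Finset.sum_congr rfl fun r _ => ?_
        rw [winners, Finset.sum_biUnion fun u _ w _ huw => Finset.disjoint_left.2
          fun e h1 h2 => huw (voters_unique h1 h2), Finset.sum_filter]
        refine Finset.sum_congr rfl fun v _ => ?_
        split_ifs with h
        · simp only [h, and_true]
          rw [← Finset.sum_filter]
          refine Finset.sum_congr (Finset.ext fun e => ?_) fun _ _ => rfl
          rw [Finset.mem_filter]
          exact ⟨fun h => h.2, fun h => ⟨(Finset.mem_filter.1 h).1, h⟩⟩
        · simp [h]
    _ = _ := by
        refine Finset.sum_congr rfl fun r _ => ?_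
        have h1 : ∀ v, K v ∩ winners K r = (winners K r).filter fun e => e ∈ K v := fun v => by
          ext e
          simp [and_comm]
        simp only [h1, claimants, Finset.card_filter, Nat.cast_sum]
        exact Finset.sum_comm

end Vote

/-! ### The potential -/

section Potential

variable {V : Type} [Fintype V] {C S : SimpleGraph V} {out out' : V → Set V}

/-- The number of claims at level `i`. -/
noncomputable def levelPotential (C S : SimpleGraph V) (out : V → Set V) (i : ℕ) : ℕ :=
  ∑ v, (claims (world C S out 0) v i).ncard

/-- The number of all conceivable claims at one level, plus one. -/
def potentialBase (V : Type) [Fintype V] : ℕ := Fintype.card V ^ 3 + 1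

/-- The numbers of claims at all levels, as the digits of one number: the highest level that occurs
dominates. -/
noncomputable def potential (C S : SimpleGraph V) (out : V → Set V) : ℕ :=
  ∑ i ∈ Finset.range (Nat.log 2 (maxDeg S) + 1), potentialBase V ^ i * levelPotential C S out i

theorem levelPotential_le (i : ℕ) : levelPotential C S out i ≤ Fintype.card V ^ 3 := by
  calc levelPotential C S out i ≤ ∑ _v : V, Fintype.card (V × V) := by
        refine Finset.sum_le_sum fun v _ => ?_
        rw [← Nat.card_eq_fintype_card, ← Set.ncard_univ]
        exact Set.ncard_le_ncard (Set.subset_univ _) (Set.toFinite _)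
    _ = Fintype.card V ^ 3 := by
        rw [Finset.sum_const, Fintype.card_prod, Finset.card_univ, smul_eq_mul]
        ring

theorem levelPotential_anti (h : ∀ v, out v ⊆ out' v) (i : ℕ) :
    levelPotential C S out' i ≤ levelPotential C S out i :=
  Finset.sum_le_sum fun v _ => Set.ncard_le_ncard (claims_mono h v i) (Set.toFinite _)

theorem sum_levels_lt (m : ℕ) :
    ∑ i ∈ Finset.range m, potentialBase V ^ i * levelPotential C S out i < potentialBase V ^ m := by
  have h := geom_sum_mul_add (Fintype.card V ^ 3) m
  rw [Finset.sum_mul] at h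
  refine Nat.lt_of_lt_of_eq (Nat.lt_succ_of_le ?_) h
  exact Finset.sum_le_sum fun i _ => Nat.mul_le_mul_left _ (levelPotential_le i)

theorem potential_lt : potential C S out < potentialBase V ^ (Nat.log 2 (maxDeg S) + 1) :=
  sum_levels_lt _

theorem potential_anti (h : ∀ v, out v ⊆ out' v) : potential C S out' ≤ potential C S out :=
  Finset.sum_le_sum fun i _ => Nat.mul_le_mul_left _ (levelPotential_anti h i)

theorem levelPotential_pos {v : V} {i : ℕ} (h : (core (world C S out 0) v i).Nonempty) :
    0 < levelPotential C S out i := by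
  have h1 : 0 < (core (world C S out 0) v i).ncard := (Set.ncard_pos (Set.toFinite _)).2 h
  have h2 := two_pow_mul_ncard_core_le (world C S out 0) v i
  have h3 : 0 < 2 ^ i * (core (world C S out 0) v i).ncard := by positivity
  exact (h3.trans_le h2).trans_le (Finset.single_le_sum
    (f := fun v => (claims (world C S out 0) v i).ncard) (fun _ _ => Nat.zero_le _)
    (Finset.mem_univ v))

/-- The potential is positive as long as some coverable client edge is uncovered. -/
theorem potential_pos (hout : ∀ v, out v ⊆ S.neighborSet v)
    (hsol : ∃ H, IsClientServerSpanner 2 C S H) (hU : (uncoveredPairs C S out).Nonempty) :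
    0 < potential C S out := by
  obtain ⟨p, hp⟩ := hU
  obtain ⟨H, hH⟩ := hsol
  have hu := (mem_uncoveredPairs 0).1 hp
  obtain ⟨w, ha, hb⟩ := covers_two_iff.1 (hH.2 _ _ hu.1)
  have hsub : insert w (H.neighborSet w) ⊆ insert w (S.neighborSet w) :=
    Set.insert_subset_insert fun x hx => hH.1 hx
  have h0 := levelPotential_pos (exists_core_zero hout (hsub ha) (hsub hb) hu)
  refine h0.trans_le ?_
  have := Finset.single_le_sum (f := fun i => potentialBase V ^ i * levelPotential C S out i)
    (s := Finset.range (Nat.log 2 (maxDeg S) + 1)) (fun _ _ => Nat.zero_le _)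
    (Finset.mem_range.2 (Nat.succ_pos _))
  simpa [potential] using this

section Drift

variable {R m : ℕ}

/-- The claims at level `m`, as finite sets. -/
noncomputable def levelClaims (C S : SimpleGraph V) (out : V → Set V) (m : ℕ) (v : V) :
    Finset (V × V) := (Set.toFinite (claims (world C S out 0) v m)).toFinset

theorem mem_levelClaims {v : V} {p : V × V} (r : V → ℕ) :
    p ∈ levelClaims C S out m v ↔ p ∈ claims (world C S out r) v m := by
  simp only [levelClaims, Set.Finite.mem_toFinset]
  exact Iff.rfl

theorem card_levelClaims (v : V) (r : V → ℕ) :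
    (levelClaims C S out m v).card = (claims (world C S out r) v m).ncard := by
  rw [levelClaims, ← Set.ncard_eq_toFinset_card]
  rfl

variable [DecidableEq V]

/-- At the highest level that occurs, the abstract voting scheme is the one of the selection rule:
no vertex of a lower level competes for the same pairs. Hence its winners get covered. -/
theorem not_uncovered_of_mem_winners
    (hm : ∀ v j, m < j → ¬ (core (world C S out 0) v j).Nonempty) (r : V → Fin (R + 1)) {p : V × V}
    (hp : p ∈ winners (levelClaims C S out m) r) (r' : V → ℕ) :
    ¬ Uncovered (world C S (nextBought (world C S out fun v => (r v : ℕ))) r') p.1 p.2 := by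
  set W := world C S out fun v => (r v : ℕ) with hW
  have hcand : ∀ w, (core W w m).Nonempty → IsCandidate W w m := fun w hw =>
    ⟨hw, fun x _ j hj => hm x j hj⟩
  obtain ⟨v, hv, hpv⟩ := Finset.mem_biUnion.1 hp
  have hsucc := (Finset.mem_filter.1 hv).2
  have hvotes : ∀ q ∈ voters (levelClaims C S out m) r v, q ∈ votes W v m := by
    intro q hq
    obtain ⟨hq1, hq2⟩ := Finset.mem_filter.1 hq
    have hqv : q ∈ claims W v m := (mem_levelClaims _).1 hq1
    refine ⟨hqv, fun w _ hwv j hj hqw => ?_⟩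
    have hjm : j = m := by
      rcases lt_trichotomy j m with h | h | h
      · exact absurd (core_nonempty_of_mem_claims hqv)
          (hj.2 v ⟨q.1, insert_core_subset_hub w j hqw.1, centre_mem_hub_of_mem_claims hqv⟩ m h)
      · exact h
      · exact absurd hj.1 (hm w j h)
    subst hjm
    exact mem_strictMin.1 hq2 w (mem_claimants.2 ((mem_levelClaims _).2 hqw)) hwv
  have hpv' := hvotes p hpv
  have hch : IsChosen W v m := by
    refine ⟨hcand v (core_nonempty_of_mem_claims hpv'.1), ?_⟩
    rw [← card_levelClaims]
    refine hsucc.trans (Nat.mul_le_mul_left _ ?_)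
    rw [← Set.ncard_coe_finset]
    exact Set.ncard_le_ncard hvotes (Set.toFinite _)
  exact not_uncovered_of_isChosen hch hpv'.1

theorem levelPotential_next_add_le
    (hm : ∀ v j, m < j → ¬ (core (world C S out 0) v j).Nonempty) (r : V → Fin (R + 1)) :
    levelPotential C S (nextBought (world C S out fun v => (r v : ℕ))) m +
      ∑ v, (levelClaims C S out m v ∩ winners (levelClaims C S out m) r).card ≤
      levelPotential C S out m := by
  unfold levelPotential
  rw [← Finset.sum_add_distrib]
  refine Finset.sum_le_sum fun v _ => ?_
  rw [← card_levelClaims, ← card_levelClaims,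
    ← Finset.card_sdiff_add_card_inter (levelClaims C S out m v)
      (winners (levelClaims C S out m) r)]
  refine Nat.add_le_add_right (Finset.card_le_card fun p hp => ?_) _
  have hp' := (mem_levelClaims 0).1 hp
  refine Finset.mem_sdiff.2 ⟨(mem_levelClaims 0).2
    (claims_mono (fun v => subset_nextBought v) v m hp'), fun hw => ?_⟩
  exact not_uncovered_of_mem_winners hm r hw 0 hp'.2.2

/-- In every iteration the potential drops by a constant factor in expectation. -/
theorem sum_potential_next_le (hR : 8 * Fintype.card V ^ 2 ≤ R + 1) :
    ∑ r : V → Fin (R + 1),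
      (potential C S (nextBought (world C S out fun v => (r v : ℕ))) : ℝ) ≤
      15 / 16 * Fintype.card (V → Fin (R + 1)) * potential C S out := by
  set N := Fintype.card (V → Fin (R + 1)) with hN
  set L := Nat.log 2 (maxDeg S) + 1 with hL
  set B := potentialBase V with hB
  set next : (V → Fin (R + 1)) → V → Set V :=
    fun r => nextBought (world C S out fun v => (r v : ℕ)) with hnext
  have hanti : ∀ r i, levelPotential C S (next r) i ≤ levelPotential C S out i := fun r i =>
    levelPotential_anti (fun v => subset_nextBought v) i
  rcases ((Finset.range L).filter fun i => 0 < levelPotential C S out i).eq_empty_or_nonempty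
    with hne | hne
  · have h0 : potential C S out = 0 := by
      refine Finset.sum_eq_zero fun i hi => ?_
      have := Finset.filter_eq_empty_iff.1 hne hi
      rw [Nat.eq_zero_of_not_pos this, mul_zero]
    have h1 : ∀ r, potential C S (next r) = 0 := fun r =>
      Nat.eq_zero_of_le_zero (h0 ▸ potential_anti fun v => subset_nextBought v)
    rw [h0, Nat.cast_zero, mul_zero]
    exact (Finset.sum_eq_zero fun r _ => by rw [← Nat.cast_zero, ← h1 r]).le
  obtain ⟨m, hmmem, hmax⟩ := Finset.exists_max_image _ id hne
  obtain ⟨hmL, hmpos⟩ := Finset.mem_filter.1 hmmem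
  have hzero : ∀ i ∈ Finset.range L, m < i → levelPotential C S out i = 0 := by
    intro i hi hmi
    by_contra h
    have := hmax i (Finset.mem_filter.2 ⟨hi, Nat.pos_of_ne_zero h⟩)
    exact absurd this (not_le.2 hmi)
  have hm : ∀ v j, m < j → ¬ (core (world C S out 0) v j).Nonempty := fun v j hj hc =>
    absurd (hzero j (Finset.mem_range.2 (lt_levels hc)) hj) (levelPotential_pos hc).ne'
  -- level `m` carries at least half of the potential
  have hhalf : potential C S out ≤ 2 * (B ^ m * levelPotential C S out m) := by
    have h1 : potential C S out =
        ∑ i ∈ Finset.range (m + 1), B ^ i * levelPotential C S out i := by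
      refine (Finset.sum_subset (Finset.range_mono (Finset.mem_range.1 hmL))
        fun i hi hi' => ?_).symm
      rw [hzero i hi (by simpa using hi'), mul_zero]
    have h2 := sum_levels_lt (C := C) (S := S) (out := out) m
    have h3 : B ^ m ≤ B ^ m * levelPotential C S out m := Nat.le_mul_of_pos_right _ hmpos
    rw [h1, Finset.sum_range_succ]
    rw [← hB] at h2
    omega
  have hstep : ∀ r, potential C S (next r) +
      B ^ m * ∑ v, (levelClaims C S out m v ∩ winners (levelClaims C S out m) r).card ≤
      potential C S out := by
    intro r
    unfold potential
    rw [← hL, ← hB, ← Finset.add_sum_erase _ _ hmL, ← Finset.add_sum_erase _ _ hmL, add_right_comm,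
      ← mul_add]
    exact Nat.add_le_add (Nat.mul_le_mul_left _ (levelPotential_next_add_le hm r))
      (Finset.sum_le_sum fun i _ => Nat.mul_le_mul_left _ (hanti r i))
  have hgain := le_sum_card_claims_inter_winners (K := levelClaims C S out m) hR
  have hlev : ∑ v, ((levelClaims C S out m v).card : ℝ) = levelPotential C S out m := by
    rw [levelPotential, Nat.cast_sum]
    exact Finset.sum_congr rfl fun v _ => by rw [card_levelClaims v 0]
  rw [hlev, ← hN] at hgain
  have hsum : ∑ r, (potential C S (next r) : ℝ) + (B : ℝ) ^ m * ∑ r : V → Fin (R + 1),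
      ∑ v, ((levelClaims C S out m v ∩ winners (levelClaims C S out m) r).card : ℝ) ≤
      N * potential C S out := by
    rw [Finset.mul_sum, ← Finset.sum_add_distrib]
    calc _ ≤ ∑ _r : V → Fin (R + 1), (potential C S out : ℝ) :=
          Finset.sum_le_sum fun r _ => by exact_mod_cast hstep r
      _ = N * potential C S out := by rw [Finset.sum_const, Finset.card_univ, nsmul_eq_mul]
  have h1 := mul_le_mul_of_nonneg_left hgain (by positivity : (0 : ℝ) ≤ (B : ℝ) ^ m)
  have hhalf' : (potential C S out : ℝ) ≤ 2 * ((B : ℝ) ^ m * levelPotential C S out m) := by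
    exact_mod_cast hhalf
  have h2 := mul_le_mul_of_nonneg_left hhalf' (Nat.cast_nonneg N : (0 : ℝ) ≤ N)
  have h3 : (B : ℝ) ^ m * ((N : ℝ) / 8 * levelPotential C S out m) =
      N * (2 * ((B : ℝ) ^ m * levelPotential C S out m)) / 16 := by ring
  linarith

end Drift

end Potential

/-! ### The distributed algorithm -/

/-- The state of a vertex. Every iteration takes seven rounds: in the phases `0, …, 5` the vertex
collects the records `known` of all vertices within distance six, and in phase `6` it applies the
selection rule to them and draws a new random number. -/
structure NodeState where
  input : ClientServerInput
  out : Set ℕ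
  draw : ℕ
  known : Set (ℕ × VertexRecord ℕ)
  phase : ℕ
  answer : Option (Set ℕ)

/-- The network as described by a set of records, with an arbitrary value at the vertices without
a record. -/
noncomputable def localWorld (known : Set (ℕ × VertexRecord ℕ)) : World ℕ := fun x =>
  @Classical.epsilon _ ⟨⟨∅, ∅, ∅, 0⟩⟩ fun ρ => (x, ρ) ∈ known

open Classical in
/-- The state after one round. A vertex announces its leaves once no uncovered client edge is left
in its server neighbourhood. -/
noncomputable def NodeState.next (s : NodeState) (inbox : Set (ℕ × Set (ℕ × VertexRecord ℕ)))
    (r : ℕ) : NodeState :=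
  if s.phase < 6 then
    { s with known := s.known ∪ {x | ∃ m ∈ inbox, x ∈ m.2}, phase := s.phase + 1 }
  else
    { input := s.input
      out := nextBought (localWorld s.known) s.input.self
      draw := r
      known := {(s.input.self, ⟨s.input.clients, s.input.servers,
        nextBought (localWorld s.known) s.input.self, r⟩)}
      phase := 0
      answer := s.answer.or
        (if IsQuiet (localWorld s.known) s.input.self then some s.out else none) }

theorem NodeState.next_of_lt {s : NodeState} {inbox : Set (ℕ × Set (ℕ × VertexRecord ℕ))} {r : ℕ}
    (h : s.phase < 6) : s.next inbox r =
      { s with known := s.known ∪ {x | ∃ m ∈ inbox, x ∈ m.2}, phase := s.phase + 1 } :=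
  if_pos h

open Classical in
theorem NodeState.next_of_not_lt {s : NodeState} {inbox : Set (ℕ × Set (ℕ × VertexRecord ℕ))}
    {r : ℕ} (h : ¬ s.phase < 6) : s.next inbox r =
      { input := s.input
        out := nextBought (localWorld s.known) s.input.self
        draw := r
        known := {(s.input.self, ⟨s.input.clients, s.input.servers,
          nextBought (localWorld s.known) s.input.self, r⟩)}
        phase := 0
        answer := s.answer.or
          (if IsQuiet (localWorld s.known) s.input.self then some s.out else none) } :=
  if_neg h

/-- The selection rule as an algorithm in the LOCAL model. -/
noncomputable def starAlgorithm : LocalAlgorithm ClientServerInput (Set ℕ) where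
  State := NodeState
  Msg := Set (ℕ × VertexRecord ℕ)
  range N := 8 * N ^ 2
  start _ i := ⟨i, ∅, 0, {(i.self, ⟨i.clients, i.servers, ∅, 0⟩)}, 0, none⟩
  send s _ := s.known
  step := NodeState.next
  output s := s.answer
  output_final s inbox r o h := by
    by_cases hp : s.phase < 6
    · rw [NodeState.next_of_lt hp]
      exact h
    · rw [NodeState.next_of_not_lt hp]
      change s.answer.or _ = some o
      rw [h]
      rfl

section Simulation

variable {V : Type} (C S : SimpleGraph V) (ident : V → ℕ)

/-- A global configuration between two iterations: the leaves bought so far, the current random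
numbers, and the announced outputs. -/
structure Config (V : Type) where
  out : V → Set V
  draw : V → ℕ
  answer : V → Option (Set ℕ)

open Classical in
/-- The configuration after one more iteration, at the end of which the numbers `r` are drawn. -/
noncomputable def Config.next (c : Config V) (r : V → ℕ) : Config V where
  out := nextBought (world C S c.out c.draw)
  draw := r
  answer v := (c.answer v).or
    (if IsQuiet (world C S c.out c.draw) v then some (ident '' c.out v) else none)

/-- The vertices within distance `j`. -/
def hopBall (G : SimpleGraph V) : ℕ → V → Set V
  | 0, v => {v}
  | j + 1, v => hopBall G j v ∪ {x | ∃ w, G.Adj v w ∧ x ∈ hopBall G j w}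

/-- The records of the vertices within distance `j`. -/
def ballRecords (c : Config V) (j : ℕ) (v : V) : Set (ℕ × VertexRecord ℕ) :=
  {m | ∃ w ∈ hopBall (C ⊔ S) j v, m = (ident w, (world C S c.out c.draw w).map ident)}

/-- The states of the vertices in phase `j` of the iteration that starts in the configuration
`c`. -/
def encode (c : Config V) (j : ℕ) : V → starAlgorithm.State := fun v =>
  NodeState.mk (clientServerInput C S ident v) (ident '' c.out v) (c.draw v)
    (ballRecords C S ident c j v) j (c.answer v)

variable {C S ident}

theorem self_mem_hopBall (G : SimpleGraph V) (j : ℕ) (v : V) : v ∈ hopBall G j v := by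
  induction j with
  | zero => exact rfl
  | succ j ih => exact Or.inl ih

theorem localWorld_ballRecords (hid : Function.Injective ident) (c : Config V) {j : ℕ} {v w : V}
    (hw : w ∈ hopBall (C ⊔ S) j v) : localWorld (ballRecords C S ident c j v) (ident w) =
      (world C S c.out c.draw w).map ident := by
  have hex : ∃ ρ, (ident w, ρ) ∈ ballRecords C S ident c j v := ⟨_, w, hw, rfl⟩
  obtain ⟨w', -, h⟩ := Classical.epsilon_spec hex
  obtain ⟨h1, h2⟩ := Prod.ext_iff.1 h
  obtain rfl := hid h1
  exact h2

theorem agree_of_forall_hopBall {W : World V} {W' : World ℕ} {f : V → ℕ}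
    (hW : ∀ v, (W v).servers = S.neighborSet v) {k : ℕ} :
    ∀ {x : V}, (∀ w ∈ hopBall (C ⊔ S) k x, W' (f w) = (W w).map f) → Agree f W W' k x := by
  induction k with
  | zero => exact fun h => h _ rfl
  | succ k ih =>
    refine fun {x} h => ⟨h _ (self_mem_hopBall _ _ _), fun y hy => ih fun w hw => h w (Or.inr ?_)⟩
    rw [hW] at hy
    exact ⟨y, Or.inr hy, hw⟩

theorem agree_localWorld (hid : Function.Injective ident) (c : Config V) (j : ℕ) (v : V) :
    Agree ident (world C S c.out c.draw) (localWorld (ballRecords C S ident c j v)) j v :=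
  agree_of_forall_hopBall (C := C) (S := S) (fun _ => rfl) fun _ hw =>
    localWorld_ballRecords hid c hw

theorem round_encode_gather (c : Config V) {j : ℕ} (hj : j < 6) (r : V → ℕ) :
    starAlgorithm.round (C ⊔ S) ident (encode C S ident c j) r = encode C S ident c (j + 1) := by
  funext v
  have hset : ballRecords C S ident c j v ∪ {x : ℕ × VertexRecord ℕ |
      ∃ m : ℕ × Set (ℕ × VertexRecord ℕ), m ∈ starAlgorithm.inbox (C ⊔ S) ident
        (encode C S ident c j) v ∧ x ∈ m.2} = ballRecords C S ident c (j + 1) v := by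
    ext x
    constructor
    · rintro (⟨w, hw, rfl⟩ | ⟨m, ⟨w, hvw, rfl⟩, u, hu, rfl⟩)
      · exact ⟨w, Or.inl hw, rfl⟩
      · exact ⟨u, Or.inr ⟨w, hvw, hu⟩, rfl⟩
    · rintro ⟨u, hu | ⟨w, hvw, hu⟩, rfl⟩
      · exact Or.inl ⟨u, hu, rfl⟩
      · exact Or.inr ⟨_, ⟨w, hvw, rfl⟩, u, hu, rfl⟩
  refine (NodeState.next_of_lt (s := encode C S ident c j v) hj).trans ?_
  refine congrArg (fun known => NodeState.mk _ _ _ known _ _) hset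

theorem ballRecords_zero (c : Config V) (v : V) :
    ballRecords C S ident c 0 v = {(ident v, (world C S c.out c.draw v).map ident)} := by
  ext x
  constructor
  · rintro ⟨w, rfl, rfl⟩; exact rfl
  · rintro rfl; exact ⟨v, rfl, rfl⟩

theorem round_encode_update (hid : Function.Injective ident) (c : Config V) (r : V → ℕ) :
    starAlgorithm.round (C ⊔ S) ident (encode C S ident c 6) r =
      encode C S ident (c.next C S ident r) 0 := by
  classical
  funext v
  have hag := agree_localWorld (C := C) (S := S) hid c 6 v
  have hnext := hag.nextBought_eq hid
  have hquiet := (hag.mono (k := 2) (by norm_num)).isQuiet_iff hid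
  refine (NodeState.next_of_not_lt (s := encode C S ident c 6 v)
    (inbox := starAlgorithm.inbox (C ⊔ S) ident (encode C S ident c 6) v) (lt_irrefl 6)).trans ?_
  change NodeState.mk _ _ _ _ _ _ = NodeState.mk _ _ _ _ _ _
  rw [ballRecords_zero, NodeState.mk.injEq]
  refine ⟨rfl, hnext, rfl, ?_, rfl, ?_⟩
  · exact congrArg (fun A => {(ident v, (⟨_, _, A, r v⟩ : VertexRecord ℕ))}) hnext
  · exact congrArg (Option.or (c.answer v)) (if_congr hquiet rfl rfl)

theorem start_eq_encode (N : ℕ) :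
    (fun v => starAlgorithm.start N (clientServerInput C S ident v)) =
      encode C S ident ⟨fun _ => ∅, 0, fun _ => none⟩ 0 := by
  funext v
  change NodeState.mk _ _ _ _ _ _ = NodeState.mk _ _ _ _ _ _
  rw [ballRecords_zero]
  simp [VertexRecord.map, world, clientServerInput]

variable [Fintype V]

/-- The distribution of independent uniform numbers in `{0, …, R}`, one for each vertex. -/
noncomputable def drawLaw (V : Type) [Fintype V] (R : ℕ) : PMF (V → ℕ) :=
  letI : DecidableEq V := Classical.decEq V
  (PMF.uniformOfFintype (V → Fin (R + 1))).map fun r v => (r v : ℕ)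

variable (C S ident) in
/-- The distribution of the configuration after the given number of iterations. The first iteration
uses the random number `0` at all vertices. -/
noncomputable def configLaw (R : ℕ) : ℕ → PMF (Config V)
  | 0 => PMF.pure ⟨fun _ => ∅, 0, fun _ => none⟩
  | i + 1 => (configLaw R i).bind fun c => (drawLaw V R).map (c.next C S ident)

theorem law_succ {Input Output : Type} (A : LocalAlgorithm Input Output) (G : SimpleGraph V)
    (N : ℕ) (input : V → Input) (t : ℕ) :
    A.law G ident N input (t + 1) = (A.law G ident N input t).bind fun σ =>
      (drawLaw V (A.range N)).map (A.round G ident σ) := by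
  simp only [LocalAlgorithm.law, drawLaw, PMF.map_comp]
  rfl

/-- Simulation: the states after `t` rounds are those of the configuration process after `t / 7`
iterations, in phase `t % 7`. -/
theorem law_eq_map_configLaw (hid : Function.Injective ident) (N t : ℕ) :
    starAlgorithm.law (C ⊔ S) ident N (clientServerInput C S ident) t =
      (configLaw C S ident (8 * N ^ 2) (t / 7)).map fun c => encode C S ident c (t % 7) := by
  induction t with
  | zero =>
    simp only [LocalAlgorithm.law, Nat.zero_div, Nat.zero_mod, configLaw, PMF.pure_map]
    rw [start_eq_encode]
  | succ t ih =>
    rw [law_succ, ih, PMF.bind_map]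
    by_cases ht : t % 7 < 6
    · have h1 : (t + 1) / 7 = t / 7 := by omega
      have h2 : (t + 1) % 7 = t % 7 + 1 := by omega
      rw [h1, h2, PMF.map]
      refine congrArg _ (funext fun c => ?_)
      have h3 : starAlgorithm.round (C ⊔ S) ident (encode C S ident c (t % 7)) =
          Function.const _ (encode C S ident c (t % 7 + 1)) :=
        funext fun r => round_encode_gather c ht r
      simp only [Function.comp_apply, h3, PMF.map_const]
    · have h0 : t % 7 = 6 := by omega
      have h1 : (t + 1) / 7 = t / 7 + 1 := by omega
      have h2 : (t + 1) % 7 = 0 := by omega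
      rw [h1, h2, h0, configLaw, PMF.map_bind]
      refine congrArg _ (funext fun c => ?_)
      rw [PMF.map_comp]
      exact congrArg (fun g => PMF.map g _) (funext fun r => round_encode_update hid c r)

end Simulation

/-! ### The guarantee in every execution -/

theorem outputGraph_adj {V : Type} {ident : V → ℕ} {out : V → Set V}
    (hid : Function.Injective ident) {u v : V} :
    (outputGraph ident fun v => ident '' out v).Adj u v ↔ u ≠ v ∧ (v ∈ out u ∨ u ∈ out v) := by
  simp [outputGraph, SimpleGraph.fromRel_adj, hid.mem_set_image]

section Guarantee

variable {V : Type} [Fintype V] {C S : SimpleGraph V} {ident : V → ℕ}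

variable (C S ident) in
/-- What holds in every reachable configuration. -/
structure Config.Valid (c : Config V) : Prop where
  out_subset : ∀ v, c.out v ⊆ S.neighborSet v
  priced : ∃ price, Priced C S c.out price
  answer_eq : ∀ v o, c.answer v = some o → o = ident '' c.out v
  quiet : ∀ v, c.answer v ≠ none → IsQuiet (world C S c.out c.draw) v

theorem Config.Valid.next {c : Config V} (hc : c.Valid C S ident) (r : V → ℕ) :
    (c.next C S ident r).Valid C S ident := by
  classical
  have hsub : ∀ v, c.out v ⊆ (c.next C S ident r).out v := fun v => subset_nextBought v
  have hanswer : ∀ v, (c.next C S ident r).answer v = (c.answer v).or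
      (if IsQuiet (world C S c.out c.draw) v then some (ident '' c.out v) else none) := fun v => by
    simp only [Config.next]
  have hquiet : ∀ v, (c.next C S ident r).answer v ≠ none →
      IsQuiet (world C S c.out c.draw) v := by
    intro v hv
    by_contra hq
    rw [hanswer, if_neg hq, Option.or_none] at hv
    exact hq (hc.quiet v hv)
  refine ⟨nextBought_subset hc.out_subset, ?_, ?_, fun v hv => (hquiet v hv).mono hsub⟩
  · obtain ⟨price, hp⟩ := hc.priced
    exact hp.next hc.out_subset c.draw
  · intro v o ho
    have hq := hquiet v (by rw [ho]; exact Option.some_ne_none o)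
    have hout : (c.next C S ident r).out v = c.out v := nextBought_eq_of_isQuiet hq
    rw [hout]
    rw [hanswer, if_pos hq] at ho
    rcases h : c.answer v with - | o'
    · rw [h] at ho
      exact (Option.some_inj.1 ho).symm
    · rw [h] at ho
      exact hc.answer_eq v o (by rw [h]; exact ho)

theorem valid_of_mem_support {R i : ℕ} {c : Config V}
    (hc : c ∈ (configLaw C S ident R i).support) : c.Valid C S ident := by
  induction i generalizing c with
  | zero =>
    rw [configLaw, PMF.support_pure, Set.mem_singleton_iff] at hc
    subst hc
    exact ⟨fun v => Set.empty_subset _, ⟨0, priced_empty⟩, fun v o h => by simp at h,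
      fun v h => absurd rfl h⟩
  | succ i ih =>
    rw [configLaw, PMF.mem_support_bind_iff] at hc
    obtain ⟨c', hc', hc⟩ := hc
    rw [PMF.mem_support_map_iff] at hc
    obtain ⟨r, -, rfl⟩ := hc
    exact (ih hc').next r

theorem edgeCount_outputGraph_le {out : V → Set V} (hid : Function.Injective ident) :
    edgeCount (outputGraph ident fun v => ident '' out v) ≤ ∑ v, (out v).ncard := by
  classical
  have hsub : (outputGraph ident fun v => ident '' out v).edgeSet ⊆
      ((Finset.univ.sigma fun v => (out v).toFinset).image
        fun x : (_ : V) × V => s(x.1, x.2) : Finset (Sym2 V)) := by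
    intro e
    induction e using Sym2.ind with
    | _ u v =>
      intro h
      rw [SimpleGraph.mem_edgeSet, outputGraph_adj hid] at h
      simp only [Finset.coe_image, Set.mem_image, Finset.mem_coe, Finset.mem_sigma,
        Finset.mem_univ, true_and, Set.mem_toFinset]
      rcases h.2 with h | h
      · exact ⟨⟨u, v⟩, h, rfl⟩
      · exact ⟨⟨v, u⟩, h, Sym2.eq_swap⟩
  refine (Set.ncard_le_ncard hsub (Set.toFinite _)).trans ?_
  rw [Set.ncard_coe_finset]
  refine Finset.card_image_le.trans (le_of_eq ?_)
  rw [Finset.card_sigma]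
  exact Finset.sum_congr rfl fun v _ => (Set.ncard_eq_toFinset_card' _).symm

theorem isClientServerSpanner_outputGraph {out : V → Set V} (hid : Function.Injective ident)
    (hout : ∀ v, out v ⊆ S.neighborSet v) (hU : uncoveredPairs C S out = ∅) :
    IsClientServerSpanner 2 C S (outputGraph ident fun v => ident '' out v) := by
  refine ⟨fun u v h => ?_, fun a b hab => ?_⟩
  · rcases ((outputGraph_adj hid).1 h).2 with h | h
    · exact hout u h
    · exact SimpleGraph.Adj.symm (hout v h)
  · have hsub : ∀ w, insert w (out w) ⊆
        insert w ((outputGraph ident fun v => ident '' out v).neighborSet w) := fun w =>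
      Set.insert_subset_insert fun x hx =>
        (outputGraph_adj hid).2 ⟨S.ne_of_adj (hout w hx), Or.inl hx⟩
    by_contra hcov
    have hp : (a, b) ∈ uncoveredPairs C S out := (mem_uncoveredPairs 0).2
      ⟨hab, fun w _ h => hcov (covers_two_iff.2 ⟨w, hsub w h.1, hsub w h.2⟩)⟩
    rw [hU] at hp
    exact absurd hp (Finset.notMem_empty _)

theorem uncoveredPairs_eq_empty_of_isQuiet {out : V → Set V} {r : V → ℕ}
    (hsol : ∃ H, IsClientServerSpanner 2 C S H) (hq : ∀ v, IsQuiet (world C S out r) v) :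
    uncoveredPairs C S out = ∅ := by
  rw [Finset.eq_empty_iff_forall_notMem]
  intro p hp
  have hu := (mem_uncoveredPairs r).1 hp
  obtain ⟨H, hH⟩ := hsol
  obtain ⟨w, ha, hb⟩ := covers_two_iff.1 (hH.2 _ _ hu.1)
  have hsub : insert w (H.neighborSet w) ⊆ hub (world C S out r) w :=
    Set.insert_subset_insert fun x hx => hH.1 hx
  exact hq w _ (hsub ha) _ (hsub hb) hu

theorem guarantee (hsol : ∃ H, IsClientServerSpanner 2 C S H) (hid : Function.Injective ident)
    {N t : ℕ} {σ : V → starAlgorithm.State}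
    (hσ : σ ∈ (starAlgorithm.law (C ⊔ S) ident N (clientServerInput C S ident) t).support)
    {o : V → Set ℕ} (ho : ∀ v, starAlgorithm.output (σ v) = some (o v)) :
    OutputsLegal (C ⊔ S) ident o ∧ IsClientServerSpanner 2 C S (outputGraph ident o) ∧
      ∀ H, IsClientServerSpanner 2 C S H → (edgeCount (outputGraph ident o) : ℝ) ≤
        208 * max 1 (min (Real.log ((edgeCount C : ℝ) / (touchedCount C : ℝ)))
          (Real.log (maxDeg S))) * (edgeCount H : ℝ) := by
  rw [law_eq_map_configLaw hid, PMF.mem_support_map_iff] at hσ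
  obtain ⟨c, hc, rfl⟩ := hσ
  have hv := valid_of_mem_support hc
  have ho' : ∀ v, c.answer v = some (o v) := ho
  obtain rfl : o = fun v => ident '' c.out v := funext fun v => hv.answer_eq v _ (ho' v)
  have hU := uncoveredPairs_eq_empty_of_isQuiet hsol fun v =>
    hv.quiet v (by rw [ho']; exact Option.some_ne_none _)
  obtain ⟨price, hp⟩ := hv.priced
  refine ⟨fun v => Set.image_mono fun x hx => Or.inr (hv.out_subset v hx),
    isClientServerSpanner_outputGraph hid hv.out_subset hU, fun H hH => ?_⟩
  refine le_trans ?_ (hp.approximation hU hH)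
  exact_mod_cast edgeCount_outputGraph_le hid

end Guarantee

/-! ### Expectations -/

section Expectation

open scoped ENNReal

/-- The expectation of a nonnegative function. -/
noncomputable def expect {α : Type} (p : PMF α) (f : α → ℝ≥0∞) : ℝ≥0∞ := ∑' x, p x * f x

theorem expect_pure {α : Type} (a : α) (f : α → ℝ≥0∞) : expect (PMF.pure a) f = f a := by
  rw [expect, tsum_eq_single a fun x hx => by rw [PMF.pure_apply_of_ne _ _ hx, zero_mul],
    PMF.pure_apply_self, one_mul]

theorem expect_bind {α β : Type} (p : PMF α) (q : α → PMF β) (f : β → ℝ≥0∞) :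
    expect (p.bind q) f = expect p fun a => expect (q a) f := by
  simp only [expect, PMF.bind_apply, ← ENNReal.tsum_mul_right, ← ENNReal.tsum_mul_left]
  rw [ENNReal.tsum_comm]
  simp only [mul_assoc]

theorem expect_map {α β : Type} (p : PMF α) (g : α → β) (f : β → ℝ≥0∞) :
    expect (p.map g) f = expect p (f ∘ g) := by
  rw [PMF.map, expect_bind]
  simp only [Function.comp_apply, expect_pure]
  rfl

theorem expect_mono {α : Type} {p : PMF α} {f g : α → ℝ≥0∞} (h : ∀ a ∈ p.support, f a ≤ g a) :
    expect p f ≤ expect p g := by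
  refine ENNReal.tsum_le_tsum fun a => ?_
  by_cases ha : a ∈ p.support
  · exact mul_le_mul_right (h a ha) _
  · rw [(PMF.apply_eq_zero_iff p a).2 ha, zero_mul, zero_mul]

theorem expect_const_mul {α : Type} (p : PMF α) (x : ℝ≥0∞) (f : α → ℝ≥0∞) :
    expect p (fun a => x * f a) = x * expect p f := by
  simp only [expect, ← ENNReal.tsum_mul_left, mul_left_comm]

theorem expect_const {α : Type} (p : PMF α) (x : ℝ≥0∞) : expect p (fun _ => x) = x := by
  rw [expect, ENNReal.tsum_mul_right, p.tsum_coe, one_mul]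

theorem toOuterMeasure_eq_expect {α : Type} (p : PMF α) (s : Set α) :
    p.toOuterMeasure s = expect p (s.indicator 1) := by
  rw [PMF.toOuterMeasure_apply, expect]
  refine tsum_congr fun a => ?_
  by_cases ha : a ∈ s <;> simp [ha]

theorem expect_uniformOfFintype {α : Type} [Fintype α] [Nonempty α] (f : α → ℝ≥0∞) :
    expect (PMF.uniformOfFintype α) f = (Fintype.card α : ℝ≥0∞)⁻¹ * ∑ a, f a := by
  simp only [expect, PMF.uniformOfFintype_apply, tsum_fintype, Finset.mul_sum]

end Expectation

/-! ### The number of rounds -/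

section Rounds

open scoped ENNReal

variable {V : Type} [Fintype V] {C S : SimpleGraph V} {ident : V → ℕ} {R : ℕ}

/-- The expected potential after one iteration with fresh random numbers. -/
theorem expect_drawLaw_potential_le (hR : 8 * Fintype.card V ^ 2 ≤ R + 1) (out : V → Set V) :
    expect (drawLaw V R) (fun r => (potential C S (nextBought (world C S out r)) : ℝ≥0∞)) ≤
      ENNReal.ofReal (15 / 16) * potential C S out := by
  let _ : DecidableEq V := Classical.decEq V
  have h := sum_potential_next_le (C := C) (S := S) (out := out) hR
  rw [drawLaw, expect_map, expect_uniformOfFintype]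
  have hN : (Fintype.card (V → Fin (R + 1)) : ℝ≥0∞) ≠ 0 := by
    exact_mod_cast Fintype.card_ne_zero
  rw [← ENNReal.div_eq_inv_mul]
  refine ENNReal.div_le_of_le_mul' ?_
  have h1 : ∑ r : V → Fin (R + 1), ((fun r => (potential C S (nextBought (world C S out r)) : ℝ≥0∞))
      ∘ fun (r : V → Fin (R + 1)) v => (r v : ℕ)) r = ENNReal.ofReal (∑ r : V → Fin (R + 1),
        (potential C S (nextBought (world C S out fun v => (r v : ℕ))) : ℝ)) := by
    rw [ENNReal.ofReal_sum_of_nonneg fun _ _ => Nat.cast_nonneg _]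
    exact Finset.sum_congr rfl fun r _ => (ENNReal.ofReal_natCast _).symm
  rw [h1]
  refine (ENNReal.ofReal_le_ofReal h).trans (le_of_eq ?_)
  rw [ENNReal.ofReal_mul (by positivity), ENNReal.ofReal_mul (by norm_num), ENNReal.ofReal_natCast,
    ENNReal.ofReal_natCast]
  ring

/-- The first iteration uses no randomness and need not make progress; each of the following ones
shrinks the expected potential by a constant factor. -/
theorem expect_potential_le (hR : 8 * Fintype.card V ^ 2 ≤ R + 1) (i : ℕ) :
    expect (configLaw C S ident R (i + 1)) (fun c => (potential C S c.out : ℝ≥0∞)) ≤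
      ENNReal.ofReal (15 / 16) ^ i *
        (potentialBase V : ℝ≥0∞) ^ (Nat.log 2 (maxDeg S) + 1) := by
  have hnext : ∀ j, expect (configLaw C S ident R (j + 1))
      (fun c => (potential C S c.out : ℝ≥0∞)) = expect (configLaw C S ident R j)
        (fun c => (potential C S (nextBought (world C S c.out c.draw)) : ℝ≥0∞)) := by
    intro j
    rw [configLaw, expect_bind]
    refine congrArg _ (funext fun c => ?_)
    rw [expect_map]
    exact expect_const (drawLaw V R)
      (potential C S (nextBought (world C S c.out c.draw)) : ℝ≥0∞)
  induction i with
  | zero =>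
    rw [hnext, pow_zero, one_mul, ← expect_const (configLaw C S ident R 0)
      ((potentialBase V : ℝ≥0∞) ^ (Nat.log 2 (maxDeg S) + 1))]
    exact expect_mono fun c _ => by exact_mod_cast potential_lt.le
  | succ i ih =>
    rw [hnext, configLaw, expect_bind]
    calc _ ≤ expect (configLaw C S ident R i) (fun c => ENNReal.ofReal (15 / 16) *
          (potential C S (nextBought (world C S c.out c.draw)) : ℝ≥0∞)) := by
          refine expect_mono fun c _ => ?_
          rw [expect_map]
          exact expect_drawLaw_potential_le hR _
      _ = ENNReal.ofReal (15 / 16) * expect (configLaw C S ident R (i + 1))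
          (fun c => (potential C S c.out : ℝ≥0∞)) := by rw [expect_const_mul, hnext]
      _ ≤ _ := by
          rw [pow_succ', mul_assoc]
          exact mul_le_mul_right ih _

/-- All vertices have announced their outputs, except with the probability that the potential is
still positive one iteration earlier. -/
theorem expect_not_answered_le (hsol : ∃ H, IsClientServerSpanner 2 C S H) (i : ℕ) :
    expect (configLaw C S ident R (i + 1)) ({c | ∃ v, c.answer v = none}.indicator 1) ≤
      expect (configLaw C S ident R i) (fun c => (potential C S c.out : ℝ≥0∞)) := by
  classical
  rw [configLaw, expect_bind]
  refine expect_mono fun c hc => ?_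
  have hv := valid_of_mem_support hc
  rw [expect_map, ← expect_const (drawLaw V R) (potential C S c.out : ℝ≥0∞)]
  refine expect_mono fun r _ => ?_
  rcases (uncoveredPairs C S c.out).eq_empty_or_nonempty with hU | hU
  · -- without uncovered pairs every vertex is quiet and announces its output
    have hall : ∀ v, IsQuiet (world C S c.out c.draw) v := fun v a _ b _ hu => by
      have := (mem_uncoveredPairs (p := (a, b)) c.draw).2 hu
      rw [hU] at this
      exact absurd this (Finset.notMem_empty _)
    have hnot : c.next C S ident r ∉ {c : Config V | ∃ v, c.answer v = none} := by
      rintro ⟨v, hv⟩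
      simp [Config.next, hall v] at hv
    rw [Function.comp_apply, Set.indicator_of_notMem hnot]
    exact zero_le
  · have hpos := potential_pos hv.out_subset hsol hU
    refine (Set.indicator_le_self' (fun _ _ => zero_le) _).trans ?_
    rw [Pi.one_apply]
    exact_mod_cast hpos

theorem not_done_le (hsol : ∃ H, IsClientServerSpanner 2 C S H) (hid : Function.Injective ident)
    {N t i : ℕ} (hN : Fintype.card V ≤ N) (ht : t / 7 = i + 2) :
    (starAlgorithm.law (C ⊔ S) ident N (clientServerInput C S ident) t).toOuterMeasure
      {σ | ¬ starAlgorithm.Done σ} ≤ ENNReal.ofReal (15 / 16) ^ i *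
        (potentialBase V : ℝ≥0∞) ^ (Nat.log 2 (maxDeg S) + 1) := by
  have hR : 8 * Fintype.card V ^ 2 ≤ 8 * N ^ 2 + 1 :=
    (Nat.mul_le_mul_left 8 (Nat.pow_le_pow_left hN 2)).trans (Nat.le_succ _)
  refine le_trans ?_ (expect_potential_le (C := C) (S := S) (ident := ident) hR i)
  refine le_trans ?_ (expect_not_answered_le hsol (i + 1))
  rw [law_eq_map_configLaw hid, ht, PMF.toOuterMeasure_map_apply, toOuterMeasure_eq_expect]
  refine expect_mono fun c _ => Set.indicator_le_indicator_of_subset ?_ (fun _ => zero_le) c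
  intro c hc
  by_contra h
  refine hc fun v => ?_
  have hne : c.answer v ≠ none := fun hv => h ⟨v, hv⟩
  exact Option.ne_none_iff_exists'.1 hne

/-- A connected solvable instance with server degree at most one has at most two vertices. -/
theorem card_le_two (hconn : (C ⊔ S).Connected) (hsol : ∃ H, IsClientServerSpanner 2 C S H)
    (hdeg : maxDeg S ≤ 1) : Fintype.card V ≤ 2 := by
  classical
  obtain ⟨v⟩ := hconn.nonempty
  set A := insert v (S.neighborSet v) with hA
  have hS : ∀ u x, u ∈ A → S.Adj u x → x ∈ A := by
    rintro u x (rfl | hu) hux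
    · exact Or.inr hux
    · have h1 : (S.neighborSet u).ncard ≤ 1 := (ncard_neighborSet_le_maxDeg S u).trans hdeg
      exact Or.inl ((Set.ncard_le_one (Set.toFinite _)).1 h1 x hux v (SimpleGraph.Adj.symm hu))
  have hadj : ∀ u x, u ∈ A → (C ⊔ S).Adj u x → x ∈ A := by
    rintro u x hu (hux | hux)
    · obtain ⟨H, hH⟩ := hsol
      obtain ⟨w, hwu, hwx⟩ := covers_two_iff.1 (hH.2 u x hux)
      have hw : w ∈ A := by
        rcases hwu with rfl | hwu
        · exact hu
        · exact hS u w hu (hH.1 (SimpleGraph.Adj.symm hwu))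
      rcases hwx with rfl | hwx
      · exact hw
      · exact hS w x hw (hH.1 hwx)
    · exact hS u x hu hux
  have hall : ∀ x, x ∈ A := by
    intro x
    obtain ⟨p⟩ := hconn.preconnected v x
    have hwalk : ∀ (u y : V), (C ⊔ S).Walk u y → u ∈ A → y ∈ A := by
      intro u y q
      induction q with
      | nil => exact id
      | cons h _ ih => exact fun hu => ih (hadj _ _ hu h)
    exact hwalk v x p (Or.inl rfl)
  have h1 : A.ncard ≤ 2 := (Set.ncard_insert_le _ _).trans
    (Nat.succ_le_succ ((ncard_neighborSet_le_maxDeg S v).trans hdeg))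
  rwa [Set.eq_univ_of_forall hall, Set.ncard_univ, Nat.card_eq_fintype_card] at h1

theorem levels_mul_log_le (hconn : (C ⊔ S).Connected)
    (hsol : ∃ H, IsClientServerSpanner 2 C S H) :
    ((Nat.log 2 (maxDeg S) + 1 : ℕ) : ℝ) * Real.log (Fintype.card V) ≤
      3 * max 1 (Real.log (Fintype.card V) * Real.log (maxDeg S)) := by
  have hlog2 := Real.log_two_gt_d9
  have hlog2' := Real.log_two_lt_d9
  have hn : 0 ≤ Real.log (Fintype.card V) := Real.log_natCast_nonneg _
  rcases le_or_gt (maxDeg S) 1 with hd | hd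
  · have hl : Nat.log 2 (maxDeg S) = 0 := Nat.log_of_lt (by omega)
    have hcard : Real.log (Fintype.card V) ≤ Real.log 2 := by
      have := hconn.nonempty
      refine Real.log_le_log (by exact_mod_cast Fintype.card_pos) ?_
      exact_mod_cast card_le_two hconn hsol hd
    have := le_max_left 1 (Real.log (Fintype.card V) * Real.log (maxDeg S))
    rw [hl]
    push_cast
    linarith
  · have h2 : (2 : ℝ) ≤ maxDeg S := by exact_mod_cast hd
    have hpow : (2 : ℝ) ^ Nat.log 2 (maxDeg S) ≤ maxDeg S := by
      exact_mod_cast Nat.pow_log_le_self 2 (by omega)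
    have h3 := Real.log_le_log (by positivity) hpow
    rw [Real.log_pow] at h3
    have h4 := Real.log_le_log (by norm_num) h2
    have h5 : ((Nat.log 2 (maxDeg S) + 1 : ℕ) : ℝ) ≤ 3 * Real.log (maxDeg S) := by
      push_cast
      have hk : (0 : ℝ) ≤ Nat.log 2 (maxDeg S) := Nat.cast_nonneg _
      nlinarith
    have h6 := mul_le_mul_of_nonneg_right h5 hn
    have h7 := le_max_right 1 (Real.log (Fintype.card V) * Real.log (maxDeg S))
    linarith

theorem pow_mul_base_pow_le {n i L c : ℕ} (hn : 2 ≤ n) (hL : 1 ≤ L)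
    (hi : 16 * ((4 + c) * (L * Real.log n)) ≤ i) :
    (15 / 16 : ℝ) ^ i * ((n : ℝ) ^ 3 + 1) ^ L ≤ 1 / (n : ℝ) ^ c := by
  have hn' : (2 : ℝ) ≤ n := by exact_mod_cast hn
  have hn0 : (0 : ℝ) < n := by linarith
  have hlog : 0 ≤ Real.log n := Real.log_natCast_nonneg _
  have hbase : (n : ℝ) ^ 3 + 1 ≤ n ^ 4 := by
    nlinarith [pow_pos hn0 3, pow_le_pow_left₀ (by norm_num) hn' 3]
  have h1 : ((n : ℝ) ^ 3 + 1) ^ L ≤ Real.exp (4 * L * Real.log n) := by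
    refine (pow_le_pow_left₀ (by positivity) hbase L).trans (le_of_eq ?_)
    rw [← pow_mul, ← Real.exp_log hn0, ← Real.exp_nat_mul, Real.log_exp]
    push_cast
    ring_nf
  have h2 : (15 / 16 : ℝ) ^ i ≤ Real.exp (-(i / 16)) := by
    have h3 : (15 / 16 : ℝ) ≤ Real.exp (-(1 / 16)) := by
      have := Real.add_one_le_exp (-(1 / 16 : ℝ))
      linarith
    refine (pow_le_pow_left₀ (by norm_num) h3 i).trans (le_of_eq ?_)
    rw [← Real.exp_nat_mul]
    ring_nf
  have h4 : 1 / (n : ℝ) ^ c = Real.exp (-(c * Real.log n)) := by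
    rw [Real.exp_neg, Real.exp_nat_mul, Real.exp_log hn0, one_div]
  rw [h4]
  refine (mul_le_mul h2 h1 (by positivity) (by positivity)).trans ?_
  rw [← Real.exp_add, Real.exp_le_exp]
  have hL' : (1 : ℝ) ≤ L := by exact_mod_cast hL
  have h5 : (c : ℝ) * Real.log n ≤ c * (L * Real.log n) :=
    mul_le_mul_of_nonneg_left (le_mul_of_one_le_left hlog hL') (Nat.cast_nonneg _)
  linarith

theorem le_probability_done (hconn : (C ⊔ S).Connected)
    (hsol : ∃ H, IsClientServerSpanner 2 C S H) (hid : Function.Injective ident) {N t c : ℕ}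
    (hN : Fintype.card V ≤ N)
    (ht : (21 + 336 * (4 + c)) * max 1 (Real.log (Fintype.card V) * Real.log (maxDeg S)) ≤
      (t : ℝ)) :
    1 - 1 / (Fintype.card V : ℝ) ^ c ≤
      ((starAlgorithm.law (C ⊔ S) ident N (clientServerInput C S ident) t).toOuterMeasure
        {σ | starAlgorithm.Done σ}).toReal := by
  have := hconn.nonempty
  rcases Nat.lt_or_ge (Fintype.card V) 2 with hn | hn
  · have h1 : Fintype.card V = 1 := by
      have := Fintype.card_pos (α := V)
      omega
    rw [h1]
    simp
  set X := max 1 (Real.log (Fintype.card V) * Real.log (maxDeg S)) with hX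
  set L := Nat.log 2 (maxDeg S) + 1 with hL
  have hX1 : 1 ≤ X := le_max_left _ _
  have hc0 : (0 : ℝ) ≤ c := Nat.cast_nonneg c
  have ht7 : (t : ℝ) ≤ 7 * (t / 7 : ℕ) + 6 := by
    have : t ≤ 7 * (t / 7) + 6 := by omega
    exact_mod_cast this
  have hq : 48 * ((4 + c) * X) + 2 ≤ ((t / 7 : ℕ) : ℝ) := by nlinarith
  have hq2 : 2 ≤ t / 7 := by
    have : (2 : ℝ) ≤ ((t / 7 : ℕ) : ℝ) := by
      have : 0 ≤ (4 + c) * X := by positivity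
      linarith
    exact_mod_cast this
  obtain ⟨i, hi⟩ := Nat.exists_eq_add_of_le' hq2
  have hi' : 16 * ((4 + c) * (L * Real.log (Fintype.card V))) ≤ (i : ℝ) := by
    have h1 := mul_le_mul_of_nonneg_left (levels_mul_log_le hconn hsol)
      (by positivity : (0 : ℝ) ≤ 4 + c)
    rw [hi] at hq
    push_cast at hq
    rw [← hX, ← hL] at h1
    linarith
  set p := starAlgorithm.law (C ⊔ S) ident N (clientServerInput C S ident) t with hp
  have hbad := not_done_le (C := C) (S := S) hsol hid hN hi
  rw [← hp, ← hL] at hbad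
  have hbad' : p.toOuterMeasure {σ | ¬ starAlgorithm.Done σ} ≤
      ENNReal.ofReal (1 / (Fintype.card V : ℝ) ^ c) := by
    refine hbad.trans (le_trans (le_of_eq ?_)
      (ENNReal.ofReal_le_ofReal (pow_mul_base_pow_le hn (Nat.succ_pos _) hi')))
    rw [ENNReal.ofReal_mul (by positivity), ENNReal.ofReal_pow (by norm_num),
      ENNReal.ofReal_pow (by positivity)]
    congr 2
    rw [potentialBase, ← ENNReal.ofReal_natCast]
    push_cast
    rfl
  have hone : (1 : ℝ≥0∞) ≤ p.toOuterMeasure {σ | starAlgorithm.Done σ} +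
      p.toOuterMeasure {σ | ¬ starAlgorithm.Done σ} := by
    have huniv : p.toOuterMeasure Set.univ = 1 :=
      (PMF.toOuterMeasure_apply_eq_one_iff p _).2 (Set.subset_univ _)
    rw [← huniv]
    refine (MeasureTheory.measure_mono fun σ _ => ?_).trans (MeasureTheory.measure_union_le _ _)
    exact em (starAlgorithm.Done σ)
  have hfin : p.toOuterMeasure {σ | starAlgorithm.Done σ} ≠ ⊤ := by
    refine ne_top_of_le_ne_top ENNReal.one_ne_top ?_
    rw [toOuterMeasure_eq_expect, ← expect_const p 1]
    exact expect_mono fun σ _ => Set.indicator_le_self' (fun _ _ => zero_le) _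
  have hreal := ENNReal.toReal_mono (ENNReal.add_ne_top.2 ⟨hfin, ENNReal.ofReal_ne_top⟩)
    (hone.trans (add_le_add le_rfl hbad'))
  rw [ENNReal.toReal_add hfin ENNReal.ofReal_ne_top, ENNReal.toReal_ofReal (by positivity),
    ENNReal.toReal_one] at hreal
  linarith

end Rounds

end StarGreedy

theorem mainTheorem10 :
    ∃ (A : LocalAlgorithm ClientServerInput (Set ℕ)) (α : ℝ),
      ∀ a c : ℕ, ∃ K : ℝ,
        ∀ (V : Type) [Fintype V] (C S : SimpleGraph V) (ident : V → ℕ) (N : ℕ),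
          (C ⊔ S).Connected →
          (∃ H, IsClientServerSpanner 2 C S H) →
          Function.Injective ident →
          Fintype.card V ≤ N → N ≤ Fintype.card V ^ a →
          -- the guarantee, for every outcome of the random choices
          (∀ (t : ℕ), ∀ σ ∈ (A.law (C ⊔ S) ident N (clientServerInput C S ident) t).support,
            ∀ o : V → Set ℕ, (∀ v, A.output (σ v) = some (o v)) →
              OutputsLegal (C ⊔ S) ident o ∧
              IsClientServerSpanner 2 C S (outputGraph ident o) ∧
              ∀ H, IsClientServerSpanner 2 C S H →
                (edgeCount (outputGraph ident o) : ℝ) ≤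
                  α * max 1 (min (Real.log ((edgeCount C : ℝ) / (touchedCount C : ℝ)))
                    (Real.log (maxDeg S))) * (edgeCount H : ℝ)) ∧
          -- the number of rounds, with high probability
          (∀ t : ℕ,
            K * max 1 (Real.log (Fintype.card V) * Real.log (maxDeg S)) ≤ (t : ℝ) →
              1 - 1 / (Fintype.card V : ℝ) ^ c ≤
                ((A.law (C ⊔ S) ident N (clientServerInput C S ident) t).toOuterMeasure
                  {σ | A.Done σ}).toReal) := by
  refine ⟨StarGreedy.starAlgorithm, 208, fun a c => ⟨21 + 336 * (4 + c), ?_⟩⟩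
  intro V _ C S ident N hconn hsol hid hN _
  exact ⟨fun t σ hσ o ho => StarGreedy.guarantee hsol hid hσ ho,
    fun t ht => StarGreedy.le_probability_done hconn hsol hid hN ht⟩
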